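/- Throughout, "connected" means path-connected and "cc" means (path-)connected component. \textbf{Telescopes.} Let $a_1<\dots<a_n$ be real numbers (the \emph{critical values}), $a_0=-\infty$, $a_{n+1}=+\infty$. Let $X_1,\dots,X_n$ be topological spaces and $Y_0,\dots,Y_n$ compact, locally connected spaces, all with finitely generated homology over $\mathbb Z/2$ (in each degree), and let $\phi_i:Y_i\to X_i$ and $\psi_{i-1}:Y_{i-1}\to X_i$ ($1\le i\le n$) be continuous. The \emph{telescope} $T$ is the adjunction space obtained from $Y_0\times(a_0,a_1]$, the $Y_i\times[a_i,a_{i+1}]$ for $0<i<n$, $Y_n\times[a_n,a_{n+1})$ and the $X_i\times\{a_i\}$ by identifying $(y,a_i)$ with $(\phi_i(y),a_i)$ for $y\in Y_i$ and with $(\psi_{i-1}(y),a_i)$ for $y\in Y_{i-1}$ (for $n=0$ it is $Y_0\times\mathbb R$). Let $f':T\to\mathbb R$ be the projection onto the second factor. Assume $Y_0=Y_n=\emptyset$, i.e. that $f'$ is bounded (this is automatic if $T$ is compact). \textbf{Covers.} Let $\mathcal I=\{I_\alpha\}$ be a \emph{gomic} of $Z=\mathrm{im}(f')$: a family of subsets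 of $Z$ with union $Z$, each of the form $Z\cap J$ with $J$ an open interval of $\mathbb R$, none contained in the union of the others, and such that no cc of any $\tilde I_\alpha=I_\alpha\setminus\bigcup_{\beta\ne\alpha}I_\beta$ is a singleton. \textbf{MultiNerve Mapper.} Let $\mathcal V$ be the family of all cc of all the sets $f'^{-1}(I_\alpha)$, indexed by the pairs ($\alpha$, cc of $f'^{-1}(I_\alpha)$). $\overline{\mathrm M}_{f'}(T,\mathcal I)$ is the poset of all pairs $(F,C)$ with $F$ a finite non-empty set of indices of $\mathcal V$ and $C$ a cc of the intersection of the corresponding members of $\mathcal V$, together with the least element $(\emptyset,T)$, ordered by $(F,C)\preceq(F',C')\iff F\subseteq F'$ and $C'\subseteq C$. \textbf{Combinatorial Reeb graph.} The Reeb graph $\mathrm R_{f'}(T)$ is the quotient of $T$ that identifies two points when they lie in the same cc of a level set of $f'$. The multigraph $\mathcal C(\mathrm R_{f'}(T))$ has as nodes the points of $\mathrm R_{f'}(T)$ over the critical values, i.e. the cc of the critical level sets, and as edges the cc $e$ of the sets $f'^{-1}((s,t))$, where $s<t$ are consecutive critical values; the lower (resp. upper) endpoint of $e$ is the cc of $f'^{-1}(s)$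 (resp. $f'^{-1}(t)$) that lies in the same cc of $f'^{-1}([s,t))$ (resp. $f'^{-1}((s,t])$) as $e$. \textbf{Lemma.} Suppose that every $I\in\mathcal I$ contains at most one critical value of $f'$. Then $\overline{\mathrm M}_{f'}(T,\mathcal I)$ is obtained from $\mathcal C(\mathrm R_{f'}(T))$ by subdividing some edges and splitting some vertices into two. Precisely, $\overline{\mathrm M}_{f'}(T,\mathcal I)$ is isomorphic, as a poset, to the face poset (empty face, vertices, edges) of the multigraph obtained from $\mathcal C(\mathrm R_{f'}(T))$ as follows: (1) each edge over $(s,t)$ is subdivided once for every $I\in\mathcal I$ that contains no critical value and meets $(s,t)$; that is, if there are $k$ such $I$, the edge is replaced by a path of $k+1$ edges; (2) each original node whose critical value belongs to two distinct elements of $\mathcal I$ is split into a lower and an upper copy joined by one new edge; the edges that reached the node from below are attached to the lower copy, those that left it upwards are attached to the upper copy. -/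

import Mathlib

open Set Topology

universe u v

/-! ### Oriented multigraphs, subdivisions and vertex splits -/

/-- A multigraph in which every edge has a lower and an upper endpoint. Parallel edges are
allowed. -/
structure Multigraph where
  Vert : Type u
  Edge : Type v
  lo : Edge → Vert
  hi : Edge → Vert

namespace Multigraph

/-- The faces of a multigraph: the empty face, the vertices and the edges. -/
inductive Face (G : Multigraph.{u, v}) : Type (max u v)
  | empty : Face G
  | vert : G.Vert → Face G
  | edge : G.Edge → Face G

/-- The face relation: the empty face lies below everything, a vertex lies below the edges of
which it is an endpoint. -/
inductive Face.Le (G : Multigraph.{u, v}) : G.Face → G.Face → Prop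
  | empty_le (p : G.Face) : Face.Le G .empty p
  | rfl (p : G.Face) : Face.Le G p p
  | lo (e : G.Edge) : Face.Le G (.vert (G.lo e)) (.edge e)
  | hi (e : G.Edge) : Face.Le G (.vert (G.hi e)) (.edge e)

instance (G : Multigraph.{u, v}) : PartialOrder G.Face where
  le := Face.Le G
  le_refl := Face.Le.rfl
  le_trans a b c h₁ h₂ := by
    cases h₁ with
    | empty_le => exact .empty_le _
    | rfl => exact h₂
    | lo e => cases h₂; exact .lo e
    | hi e => cases h₂; exact .hi e
  le_antisymm a b h₁ h₂ := by
    cases h₁ with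
    | empty_le => cases h₂ <;> rfl
    | rfl => rfl
    | lo e => cases h₂
    | hi e => cases h₂

/-- Subdivide every edge `e` of `G` by inserting `k e` new vertices: `e` is replaced by a path
of `k e + 1` edges, listed from bottom to top. -/
def subdivide (G : Multigraph.{u, v}) (k : G.Edge → ℕ) : Multigraph where
  Vert := G.Vert ⊕ (Σ e : G.Edge, Fin (k e))
  Edge := Σ e : G.Edge, Fin (k e + 1)
  lo := fun ⟨e, j⟩ => Fin.cases (Sum.inl (G.lo e)) (fun j => Sum.inr ⟨e, j⟩) j
  hi := fun ⟨e, j⟩ => Fin.lastCases (motive := fun _ => G.Vert ⊕ (Σ e : G.Edge, Fin (k e)))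
    (Sum.inl (G.hi e)) (fun j => Sum.inr ⟨e, j⟩) j

open Classical in
/-- Split every vertex `v ∈ S` into a lower copy `inl v` and an upper copy `inr v` joined by one
new edge. The edges that used to arrive at `v` from below end at the lower copy, the edges that
used to leave `v` upwards start at the upper copy. -/
noncomputable def split (G : Multigraph.{u, v}) (S : Set G.Vert) : Multigraph where
  Vert := G.Vert ⊕ S
  Edge := G.Edge ⊕ S
  lo := Sum.elim
    (fun e => if h : G.lo e ∈ S then Sum.inr ⟨G.lo e, h⟩ else Sum.inl (G.lo e))
    (fun v => Sum.inl v)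
  hi := Sum.elim (fun e => Sum.inl (G.hi e)) (fun v => Sum.inr v)

end Multigraph

/-! ### Connected pullback covers, multinerves, MultiNerve Mapper

"Connected" always means "path-connected". -/

/-- `C` is a (path-)connected component of the subset `S`. -/
def IsCC {X : Type u} [TopologicalSpace X] (C S : Set X) : Prop :=
  ∃ x ∈ S, C = pathComponentIn S x

/-- Index set of the connected pullback cover: pairs of an index `α` and a connected component
of `f ⁻¹' U α`. The member of the cover with index `i` is the component `i.1.2`. -/
def PullbackIndex {X : Type u} [TopologicalSpace X] {Z : Type*} {ι : Type v}
    (f : X → Z) (U : ι → Set Z) : Type (max u v) :=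
  {p : ι × Set X // IsCC p.2 (f ⁻¹' U p.1)}

/-- The connected pullback cover of `X`, as an indexed family. -/
def pullbackCover {X : Type u} [TopologicalSpace X] {Z : Type*} {ι : Type v}
    (f : X → Z) (U : ι → Set Z) (i : PullbackIndex f U) : Set X :=
  i.1.2

/-- The simplices of the multinerve of a family `V`: pairs of a finite nonempty set `F` of
indices and a connected component of `⋂ i ∈ F, V i`, together with the least element
`(∅, ⋃ i, V i)`. -/
@[ext]
structure Multinerve {X : Type u} [TopologicalSpace X] {κ : Type v} (V : κ → Set X) where
  F : Finset κ
  C : Set X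
  isSimplex : (F = ∅ ∧ C = ⋃ i, V i) ∨ (F.Nonempty ∧ IsCC C (⋂ i ∈ F, V i))

instance {X : Type u} [TopologicalSpace X] {κ : Type v} (V : κ → Set X) :
    PartialOrder (Multinerve V) where
  le s t := s.F ⊆ t.F ∧ t.C ⊆ s.C
  le_refl s := ⟨subset_rfl, subset_rfl⟩
  le_trans _ _ _ h₁ h₂ := ⟨h₁.1.trans h₂.1, h₂.2.trans h₁.2⟩
  le_antisymm _ _ h₁ h₂ :=
    Multinerve.ext (Finset.Subset.antisymm h₁.1 h₂.1) (h₂.2.antisymm h₁.2)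

/-- The MultiNerve Mapper of `(X, f)` with respect to the cover `U`, a simplicial poset. -/
abbrev MultinerveMapper {X : Type u} [TopologicalSpace X] {Z : Type*} {ι : Type v}
    (f : X → Z) (U : ι → Set Z) : Type (max u v) :=
  Multinerve (pullbackCover f U)

/-! ### Gomics -/

/-- `U` is a generic, open, minimal interval cover ("gomic") of `Z ⊆ ℝ`. -/
structure IsGomic {ι : Type v} (Z : Set ℝ) (U : ι → Set ℝ) : Prop where
  /-- The family covers `Z` (its members are subsets of `Z` by `isInterval`). -/
  covers : ⋃ α, U α = Z
  /-- Every member is an open interval of the subspace `Z`. -/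
  isInterval : ∀ α, ∃ I : Set ℝ, IsOpen I ∧ I.OrdConnected ∧ U α = I ∩ Z
  /-- No member is contained in the union of the others. -/
  minimal : ∀ α, ¬ U α ⊆ ⋃ (β : ι) (_ : β ≠ α), U β
  /-- No proper subset, i.e. no connected component of the part of `U α` that is not covered by
  the other members, is a singleton. -/
  generic : ∀ α (x : ℝ), ¬ IsCC {x} (U α \ ⋃ (β : ι) (_ : β ≠ α), U β)

/-! ### Reeb graphs -/

/-- Two points are identified if they lie in the same connected component of a level set. -/
def reebSetoid {X : Type u} [TopologicalSpace X] (f : X → ℝ) : Setoid X where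
  r x y := f x = f y ∧ JoinedIn (f ⁻¹' {f x}) x y
  iseqv :=
    { refl := fun _ => ⟨rfl, JoinedIn.refl rfl⟩
      symm := fun h => ⟨h.1.symm, h.1 ▸ h.2.symm⟩
      trans := fun h₁ h₂ => ⟨h₁.1.trans h₂.1, h₁.2.trans (h₁.1.symm ▸ h₂.2)⟩ }

/-- The Reeb graph as a quotient space. -/
def ReebSpace {X : Type u} [TopologicalSpace X] (f : X → ℝ) : Type u :=
  Quotient (reebSetoid f)

instance {X : Type u} [TopologicalSpace X] (f : X → ℝ) : TopologicalSpace (ReebSpace f) :=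
  inferInstanceAs (TopologicalSpace (Quotient (reebSetoid f)))

/-- The projection of `X` onto its Reeb graph. -/
def reebProj {X : Type u} [TopologicalSpace X] (f : X → ℝ) (x : X) : ReebSpace f :=
  Quotient.mk (reebSetoid f) x

/-- The function induced by `f` on the Reeb graph. -/
def reebMap {X : Type u} [TopologicalSpace X] (f : X → ℝ) : ReebSpace f → ℝ :=
  Quotient.lift f fun _ _ h => h.1

/-- The nodes of the combinatorial Reeb graph: the points of the Reeb graph (that is, the
connected components of level sets) at the critical values `A`. -/
def ReebNode {X : Type u} [TopologicalSpace X] (f : X → ℝ) (A : Set ℝ) : Type u :=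
  {p : ReebSpace f // reebMap f p ∈ A}

/-- The value of `f` at a node. -/
def ReebNode.height {X : Type u} [TopologicalSpace X] {f : X → ℝ} {A : Set ℝ}
    (p : ReebNode f A) : ℝ :=
  reebMap f p.1

/-- The connected component of the critical level set that a node represents. -/
def ReebNode.carrier {X : Type u} [TopologicalSpace X] {f : X → ℝ} {A : Set ℝ}
    (p : ReebNode f A) : Set X :=
  reebProj f ⁻¹' {p.1}

/-- The edges of the combinatorial Reeb graph: an edge is (the image in the Reeb graph of) a
connected component `comp` of the preimage of an open interval between two consecutive critical
values. Its lower endpoint is the node at the lower critical value to which `comp` is connected,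
its upper endpoint the node at the upper critical value to which `comp` is connected. -/
structure ReebEdge {X : Type u} [TopologicalSpace X] (f : X → ℝ) (A : Set ℝ) where
  lo : ReebNode f A
  hi : ReebNode f A
  comp : Set X
  lt : lo.height < hi.height
  consecutive : Disjoint A (Ioo lo.height hi.height)
  isCC : IsCC comp (f ⁻¹' Ioo lo.height hi.height)
  joined_lo : ∃ x ∈ lo.carrier, ∃ y ∈ comp, JoinedIn (f ⁻¹' Ico lo.height hi.height) x y
  joined_hi : ∃ x ∈ hi.carrier, ∃ y ∈ comp, JoinedIn (f ⁻¹' Ioc lo.height hi.height) x y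

/-- The combinatorial Reeb graph of `(X, f)`, where `A` is the set of critical values. -/
def combReebGraph {X : Type u} [TopologicalSpace X] (f : X → ℝ) (A : Set ℝ) : Multigraph where
  Vert := ReebNode f A
  Edge := ReebEdge f A
  lo := ReebEdge.lo
  hi := ReebEdge.hi

/-- The number of cover elements that contain no critical value and that are crossed by the edge
`e`. -/
noncomputable def crossingCount {X : Type u} [TopologicalSpace X] {f : X → ℝ} {A : Set ℝ}
    {ι : Type v} (U : ι → Set ℝ) (e : ReebEdge f A) : ℕ :=
  Set.ncard {α : ι | Disjoint (U α) A ∧ (U α ∩ Ioo e.lo.height e.hi.height).Nonempty}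

/-- The nodes whose critical value lies in the intersection of two distinct cover elements. -/
def overlapNodes {X : Type u} [TopologicalSpace X] (f : X → ℝ) (A : Set ℝ)
    {ι : Type v} (U : ι → Set ℝ) : Set (ReebNode f A) :=
  {p | ∃ α β : ι, α ≠ β ∧ p.height ∈ U α ∩ U β}

/-! ### Telescopes -/

/-- Every singular homology group of `X` with coefficients in `ℤ/2` is finitely generated. -/
def HasFGHomology (X : Type u) [TopologicalSpace X] : Prop :=
  ∀ k : ℕ, Module.Finite (ZMod 2)
    (((AlgebraicTopology.singularHomologyFunctor (ModuleCat.{u} (ZMod 2)) k).obj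
      (ModuleCat.of (ZMod 2) (ULift.{u} (ZMod 2)))).obj (TopCat.of X))

/-- The data of a telescope. The critical values are `a 0 < ⋯ < a (n-1)`; the critical slice
`X i` sits at `a i`, the cylinder below it is `Y i.castSucc`, the cylinder above it is
`Y i.succ`; `ψ i` attaches the top of the former to `X i` and `φ i` the bottom of the latter. -/
structure Telescope where
  n : ℕ
  a : Fin n → ℝ
  strictMono_a : StrictMono a
  X : Fin n → Type u
  Y : Fin (n + 1) → Type u
  [topX : ∀ i, TopologicalSpace (X i)]
  [topY : ∀ i, TopologicalSpace (Y i)]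
  [compactY : ∀ i, CompactSpace (Y i)]
  [locConnY : ∀ i, LocallyConnectedSpace (Y i)]
  homologyX : ∀ i, HasFGHomology (X i)
  homologyY : ∀ i, HasFGHomology (Y i)
  φ : ∀ i : Fin n, C(Y i.succ, X i)
  ψ : ∀ i : Fin n, C(Y i.castSucc, X i)

namespace Telescope

attribute [instance] topX topY compactY locConnY

variable (T : Telescope.{u})

/-- The set of critical values. -/
def crit : Set ℝ := range T.a

/-- The interval over which the cylinder `Y k` stands: the closed interval between the critical
values just below and just above it, unbounded where there is no such critical value. -/
def strip (k : Fin (T.n + 1)) : Set ℝ :=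
  {t | ∀ i : Fin T.n, (i.castSucc < k → T.a i ≤ t) ∧ (k ≤ i.castSucc → t ≤ T.a i)}

theorem mem_strip_succ (i : Fin T.n) : T.a i ∈ T.strip i.succ := fun j =>
  ⟨fun h => T.strictMono_a.monotone (by simpa [Fin.lt_def, Nat.lt_succ_iff] using h),
   fun h => T.strictMono_a.monotone
    (by simp only [Fin.le_def, Fin.val_succ, Fin.val_castSucc] at h ⊢; omega)⟩

theorem mem_strip_castSucc (i : Fin T.n) : T.a i ∈ T.strip i.castSucc := fun j =>
  ⟨fun h => T.strictMono_a.monotone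
    (by simp only [Fin.lt_def, Fin.val_castSucc, Fin.le_def] at h ⊢; omega),
   fun h => T.strictMono_a.monotone (by simpa using h)⟩

/-- The disjoint union of the cylinders `Y k × strip k` and of the slices `X i`, the latter
standing for `X i × {a i}`. -/
abbrev Pieces : Type u :=
  (Σ k : Fin (T.n + 1), T.Y k × T.strip k) ⊕ (Σ i : Fin T.n, T.X i)

/-- The identifications made by the attaching maps. -/
inductive Glue : T.Pieces → T.Pieces → Prop
  | bottom (i : Fin T.n) (y : T.Y i.succ) :
      Glue (Sum.inl ⟨i.succ, y, ⟨T.a i, T.mem_strip_succ i⟩⟩) (Sum.inr ⟨i, T.φ i y⟩)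
  | top (i : Fin T.n) (y : T.Y i.castSucc) :
      Glue (Sum.inl ⟨i.castSucc, y, ⟨T.a i, T.mem_strip_castSucc i⟩⟩) (Sum.inr ⟨i, T.ψ i y⟩)

/-- The underlying space of a telescope: the adjunction space, with the quotient topology. -/
def Space : Type u := Quot T.Glue

instance : TopologicalSpace T.Space := inferInstanceAs (TopologicalSpace (Quot T.Glue))

/-- The projection of a telescope onto the second factor. -/
def proj : T.Space → ℝ :=
  Quot.lift (Sum.elim (fun p => (p.2.2 : ℝ)) (fun q => T.a q.1)) (by
    rintro _ _ (⟨i, y⟩ | ⟨i, y⟩) <;> rfl)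

end Telescope

/-! Topology enters through two facts about an interval `J` whose only possible critical value is
`u`. Every point over `J` slides along a vertical line of its cylinder to the fibre over `u`.
Conversely, collapsing the vertical coordinate gives a continuous map from the part over `J` to this
fibre that fixes the fibre, so `J` adds no connections between its points. `IsTelescopic` records
these facts, together with the shape of the image, and `Telescope.isTelescopic` proves them. By
`IsTelescopic.joinedIn_of_subset`, connections over such an interval may then be tested over any
subinterval containing `u`, and the rest is combinatorics on the line.

The image is compact, so minimality makes the gomic finite. Having at most one critical value makes
each member a genuine interval. Ordering the members by points that they share with no other member
gives a sequence in which only consecutive members meet (`IsLinearCover`). The multinerve therefore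
has dimension at most one: its vertices are the components over the `U i`, its edges the components
over the `U i ∩ U (i + 1)`.

A member with a critical value has one vertex for each node at that value; a member without one has
one vertex for each Reeb edge crossing it. A critical value in two members yields two copies of its
nodes and an edge between the copies. Along a Reeb edge, let `h` be the last member containing the
lower end and `l` the first containing the upper end. The members strictly between `h` and `l` are
those counted by `crossingCount`, and the `l - h` overlaps are the edges of the subdivided path
(`highIndex_add_crossingCount`). `MultinerveModel` turns this dictionary into the isomorphism of
posets. -/

/-! ### Path components of subsets and of intersections -/

theorem IsCC.eq_pathComponentIn {X : Type u} [TopologicalSpace X] {C S : Set X} (h : IsCC C S)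
    {x : X} (hx : x ∈ C) : C = pathComponentIn S x := by
  obtain ⟨y, _, rfl⟩ := h
  exact (pathComponentIn_congr hx).symm

theorem IsCC.nonempty {X : Type u} [TopologicalSpace X] {C S : Set X} (h : IsCC C S) :
    C.Nonempty := by
  obtain ⟨y, hy, rfl⟩ := h
  exact ⟨y, mem_pathComponentIn_self hy⟩

theorem IsCC.subset {X : Type u} [TopologicalSpace X] {C S : Set X} (h : IsCC C S) : C ⊆ S := by
  obtain ⟨y, hy, rfl⟩ := h
  exact pathComponentIn_subset

theorem isCC_pathComponentIn {X : Type u} [TopologicalSpace X] {S : Set X} {x : X} (hx : x ∈ S) :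
    IsCC (pathComponentIn S x) S := ⟨x, hx, rfl⟩

theorem IsCC.eq_of_mem {X : Type u} [TopologicalSpace X] {C C' S : Set X} (h : IsCC C S)
    (h' : IsCC C' S) {x : X} (hx : x ∈ C) (hx' : x ∈ C') : C = C' := by
  rw [h.eq_pathComponentIn hx, h'.eq_pathComponentIn hx']

theorem IsCC.joinedIn {X : Type u} [TopologicalSpace X] {C S : Set X} (h : IsCC C S)
    {x y : X} (hx : x ∈ C) (hy : y ∈ C) : JoinedIn S x y := by
  rw [h.eq_pathComponentIn hx] at hy
  exact hy

/-- If each `V i` is a connected component of `W i`, then the connected components of `⋂ V i` are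
components of `⋂ W i`. -/
theorem pathComponentIn_iInter_components {X : Type u} [TopologicalSpace X] {κ : Type*}
    {V W : κ → Set X} (h : ∀ i, IsCC (V i) (W i)) (F : Finset κ) {x : X}
    (hx : x ∈ ⋂ i ∈ F, V i) :
    pathComponentIn (⋂ i ∈ F, V i) x = pathComponentIn (⋂ i ∈ F, W i) x := by
  have hx' : x ∈ ⋂ i ∈ F, W i := iInter₂_mono (fun i _ => (h i).subset) hx
  apply Subset.antisymm
  · exact pathComponentIn_mono (iInter₂_mono fun i _ => (h i).subset)
  -- The larger component is path-connected, contains `x` and lies in every `W i`, so it cannot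
  -- leave the component `V i` of `W i`.
  · refine (isPathConnected_pathComponentIn hx').subset_pathComponentIn
      (mem_pathComponentIn_self hx') (subset_iInter₂ fun i hi => ?_)
    rw [(h i).eq_pathComponentIn (mem_iInter₂.1 hx i hi)]
    exact pathComponentIn_mono (biInter_subset_of_mem hi)

/-! ### The order on a multinerve and passage to disconnected families -/

namespace Multinerve

variable {X : Type u} [TopologicalSpace X] {κ : Type v} {V : κ → Set X}

/-- The simplex with nonempty index set `F` and component through `x`. -/
def ofPoint (V : κ → Set X) (F : Finset κ) (hF : F.Nonempty) (x : X) (hx : x ∈ ⋂ i ∈ F, V i) :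
    Multinerve V :=
  ⟨F, pathComponentIn (⋂ i ∈ F, V i) x, Or.inr ⟨hF, isCC_pathComponentIn hx⟩⟩

/-- The least simplex. -/
def bot (V : κ → Set X) : Multinerve V := ⟨∅, ⋃ i, V i, Or.inl ⟨rfl, rfl⟩⟩

theorem eq_bot_or_eq_ofPoint (s : Multinerve V) :
    s = bot V ∨ ∃ hF x hx, s = ofPoint V s.F hF x hx := by
  obtain ⟨F, C, ⟨rfl, rfl⟩ | ⟨hF, x, hx, rfl⟩⟩ := s
  · exact Or.inl rfl
  · exact Or.inr ⟨hF, x, hx, rfl⟩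

theorem isCC_C (s : Multinerve V) (hs : s.F.Nonempty) : IsCC s.C (⋂ i ∈ s.F, V i) :=
  (s.isSimplex.resolve_left fun h => hs.ne_empty h.1).2

/-- A component of the smaller intersection lies in a single component of the larger one, so one
sample point of each simplex decides the order. The least simplex is excluded as `s` because its set
is a union, not a component. -/
theorem le_iff_joinedIn {s t : Multinerve V} (hs : s.F.Nonempty) {x y : X} (hx : x ∈ s.C)
    (hy : y ∈ t.C) : s ≤ t ↔ s.F ⊆ t.F ∧ JoinedIn (⋂ i ∈ s.F, V i) x y := by
  refine and_congr_right fun h => ?_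
  rw [(s.isCC_C hs).eq_pathComponentIn hx, (t.isCC_C (hs.mono h)).eq_pathComponentIn hy]
  rw [(t.isCC_C (hs.mono h)).eq_pathComponentIn hy] at hy
  refine ⟨fun h' => h' hy, fun h' => ?_⟩
  rw [← pathComponentIn_congr (show y ∈ pathComponentIn _ x from h')]
  exact pathComponentIn_mono (biInter_subset_biInter_left h)

theorem mem_C_ofPoint {F : Finset κ} (hF : F.Nonempty) {x : X} (hx : x ∈ ⋂ i ∈ F, V i) :
    x ∈ (ofPoint V F hF x hx).C :=
  mem_pathComponentIn_self hx

theorem bot_le' (s : Multinerve V) : bot V ≤ s := by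
  obtain rfl | ⟨hF, x, hx, hs⟩ := s.eq_bot_or_eq_ofPoint
  · exact le_rfl
  · rw [hs]
    refine ⟨Finset.empty_subset _, fun y hy => ?_⟩
    obtain ⟨i, hi⟩ := hF
    exact mem_iUnion.2 ⟨i, mem_iInter₂.1 (pathComponentIn_subset hy) i hi⟩

theorem F_eq_empty_of_le_bot {s : Multinerve V} (h : s ≤ bot V) : s.F = ∅ :=
  Finset.subset_empty.1 h.1

open Classical in
/-- A family whose members are the connected components of the members of `W`, each listed once,
has the same multinerve as `W`. -/
theorem nonempty_orderIso_of_components {l : Type*} {W : l → Set X} (g : κ → l)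
    (hV : ∀ k, IsCC (V k) (W (g k))) (hinj : ∀ k k', g k = g k' → V k = V k' → k = k')
    (hsurj : ∀ i C, IsCC C (W i) → ∃ k, g k = i ∧ V k = C) :
    Nonempty (Multinerve V ≃o Multinerve W) := by
  have hW : ∀ F : Finset κ, ⋂ i ∈ F.image g, W i = ⋂ k ∈ F, W (g k) := fun F => by
    ext x; simp
  have hU : ⋃ k, V k = ⋃ i, W i := by
    apply Subset.antisymm
    · exact iUnion_subset fun k => (hV k).subset.trans (subset_iUnion W (g k))
    · refine iUnion_subset fun i x hx => ?_
      obtain ⟨k, -, hk⟩ := hsurj i _ (isCC_pathComponentIn hx)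
      exact mem_iUnion.2 ⟨k, hk ▸ mem_pathComponentIn_self hx⟩
  let φ : Multinerve V → Multinerve W := fun s => ⟨s.F.image g, s.C, by
    obtain ⟨F, C, ⟨rfl, rfl⟩ | ⟨hF, x, hx, rfl⟩⟩ := s
    · exact Or.inl ⟨by simp, hU⟩
    · refine Or.inr ⟨hF.image g, x, ?_, ?_⟩
      · rw [hW]; exact iInter₂_mono (fun k _ => (hV k).subset) hx
      · rw [hW]; exact pathComponentIn_iInter_components hV F hx⟩
  have hle : ∀ s t, φ s ≤ φ t ↔ s ≤ t := by
    intro s t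
    refine ⟨fun h => ⟨fun k hk => ?_, h.2⟩, fun h => ⟨Finset.image_subset_image h.1, h.2⟩⟩
    obtain ⟨k', hk', hg⟩ := Finset.mem_image.1 (h.1 (Finset.mem_image_of_mem g hk))
    -- The sets `V k` and `V k'` are components of the same member of `W`, and both contain any
    -- point of `t.C`; hence they coincide, and so do their indices.
    have hs : ∀ s : Multinerve V, ∀ k ∈ s.F, s.C ⊆ V k := by
      rintro ⟨F, C, ⟨rfl, rfl⟩ | ⟨hF, hC⟩⟩ k hk
      · simp at hk
      · exact hC.subset.trans (biInter_subset_of_mem hk)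
    have ht : t.C.Nonempty := by
      obtain ⟨F, C, ⟨rfl, rfl⟩ | ⟨hF, hC⟩⟩ := t
      · simp at hk'
      · exact hC.nonempty
    obtain ⟨x, hx⟩ := ht
    rw [← hinj k' k hg ((hV k').eq_of_mem (hg ▸ hV k) (hs t k' hk' hx) (hs s k hk (h.2 hx)))]
    exact hk'
  refine ⟨RelIso.ofSurjective (OrderEmbedding.ofMapLEIff φ hle) ?_⟩
  rintro ⟨F, C, ⟨rfl, rfl⟩ | ⟨hF, x, hx, rfl⟩⟩
  · exact ⟨bot V, Multinerve.ext rfl hU⟩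
  -- Each index `i` is lifted to the component of `W i` through the fixed point `x`.
  · choose k hk hk' using fun i : F =>
      hsurj i _ (isCC_pathComponentIn (mem_iInter₂.1 hx i.1 i.2))
    have himg : (F.attach.image k).image g = F := by
      ext i
      simp [hk]
    have hx' : x ∈ ⋂ j ∈ F.attach.image k, V j := by
      refine mem_iInter₂.2 fun j hj => ?_
      obtain ⟨i, -, rfl⟩ := Finset.mem_image.1 hj
      rw [hk']
      exact mem_pathComponentIn_self (mem_iInter₂.1 hx i.1 i.2)
    refine ⟨ofPoint V (F.attach.image k) (hF.attach.image k) x hx', Multinerve.ext himg ?_⟩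
    change pathComponentIn _ x = pathComponentIn _ x
    rw [pathComponentIn_iInter_components hV _ hx', ← hW, himg]

end Multinerve

/-! ### Multinerves of families in which only consecutive members meet -/

/-- Indices and representatives of the vertices and edges of a multigraph `G` that exhibit it as
the multinerve of a family `W` in which only consecutive members meet. -/
structure MultinerveModel {X : Type u} [TopologicalSpace X] (G : Multigraph.{u, v})
    (W : ℕ → Set X) where
  vi : G.Vert → ℕ
  vx : G.Vert → X
  ei : G.Edge → ℕ
  ex : G.Edge → X
  disjoint : ∀ i j, i + 1 < j → Disjoint (W i) (W j)
  vx_mem : ∀ v, vx v ∈ W (vi v)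
  ex_mem : ∀ e, ex e ∈ W (ei e) ∩ W (ei e + 1)
  vert_inj : ∀ v v', vi v = vi v' → JoinedIn (W (vi v)) (vx v) (vx v') → v = v'
  vert_surj : ∀ i, ∀ x ∈ W i, ∃ v, vi v = i ∧ JoinedIn (W i) (vx v) x
  edge_inj : ∀ e e', ei e = ei e' → JoinedIn (W (ei e) ∩ W (ei e + 1)) (ex e) (ex e') → e = e'
  edge_surj : ∀ i, ∀ x ∈ W i ∩ W (i + 1), ∃ e, ei e = i ∧ JoinedIn (W i ∩ W (i + 1)) (ex e) x
  vi_lo : ∀ e, vi (G.lo e) = ei e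
  vi_hi : ∀ e, vi (G.hi e) = ei e + 1
  joined_lo : ∀ e, JoinedIn (W (ei e)) (vx (G.lo e)) (ex e)
  joined_hi : ∀ e, JoinedIn (W (ei e + 1)) (vx (G.hi e)) (ex e)

namespace MultinerveModel

theorem iInter_singleton {X : Type u} {W : ℕ → Set X} (i : ℕ) :
    ⋂ j ∈ ({i} : Finset ℕ), W j = W i := by simp

theorem iInter_pair {X : Type u} {W : ℕ → Set X} (i : ℕ) :
    ⋂ j ∈ ({i, i + 1} : Finset ℕ), W j = W i ∩ W (i + 1) := by simp

variable {X : Type u} [TopologicalSpace X] {G : Multigraph.{u, v}} {W : ℕ → Set X}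

/-- The simplex corresponding to a face. -/
def simplex (M : MultinerveModel G W) : G.Face → Multinerve W
  | .empty => .bot W
  | .vert v => .ofPoint W {M.vi v} (by simp) (M.vx v) (by rw [iInter_singleton]; exact M.vx_mem v)
  | .edge e => .ofPoint W {M.ei e, M.ei e + 1} (by simp) (M.ex e)
      (by rw [iInter_pair]; exact M.ex_mem e)

theorem vx_mem_simplex (M : MultinerveModel G W) (v : G.Vert) :
    M.vx v ∈ (M.simplex (.vert v)).C :=
  mem_pathComponentIn_self (by rw [iInter_singleton]; exact M.vx_mem v)

theorem ex_mem_simplex (M : MultinerveModel G W) (e : G.Edge) :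
    M.ex e ∈ (M.simplex (.edge e)).C :=
  mem_pathComponentIn_self (by rw [iInter_pair]; exact M.ex_mem e)

theorem simplex_vert_le (M : MultinerveModel G W) {v : G.Vert} {s : Multinerve W} {x : X}
    (hx : x ∈ s.C) :
    M.simplex (.vert v) ≤ s ↔ M.vi v ∈ s.F ∧ JoinedIn (W (M.vi v)) (M.vx v) x := by
  have h := Multinerve.le_iff_joinedIn (s := M.simplex (.vert v)) (t := s)
    (Finset.singleton_nonempty _) (M.vx_mem_simplex v) hx
  rw [h]
  change {M.vi v} ⊆ s.F ∧ JoinedIn (⋂ j ∈ ({M.vi v} : Finset ℕ), W j) _ _ ↔ _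
  rw [iInter_singleton, Finset.singleton_subset_iff]

theorem simplex_edge_le (M : MultinerveModel G W) {e : G.Edge} {s : Multinerve W} {x : X}
    (hx : x ∈ s.C) :
    M.simplex (.edge e) ≤ s ↔ (M.ei e ∈ s.F ∧ M.ei e + 1 ∈ s.F) ∧
      JoinedIn (W (M.ei e) ∩ W (M.ei e + 1)) (M.ex e) x := by
  have h := Multinerve.le_iff_joinedIn (s := M.simplex (.edge e)) (t := s)
    (Finset.insert_nonempty _ _) (M.ex_mem_simplex e) hx
  rw [h]
  change {M.ei e, M.ei e + 1} ⊆ s.F ∧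
    JoinedIn (⋂ j ∈ ({M.ei e, M.ei e + 1} : Finset ℕ), W j) _ _ ↔ _
  rw [iInter_pair, Finset.insert_subset_iff, Finset.singleton_subset_iff]

theorem mem_simplex_vert_F (M : MultinerveModel G W) {v : G.Vert} {i : ℕ} :
    i ∈ (M.simplex (.vert v)).F ↔ i = M.vi v :=
  Finset.mem_singleton

theorem mem_simplex_edge_F (M : MultinerveModel G W) {e : G.Edge} {i : ℕ} :
    i ∈ (M.simplex (.edge e)).F ↔ i = M.ei e ∨ i = M.ei e + 1 := by
  change i ∈ ({M.ei e, M.ei e + 1} : Finset ℕ) ↔ _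
  simp

theorem simplex_le (M : MultinerveModel G W) (p q : G.Face) :
    M.simplex p ≤ M.simplex q ↔ p ≤ q := by
  constructor
  · intro h
    rcases p with _ | v | e
    · exact .empty_le _
    · rcases q with _ | v' | e'
      · exact (Finset.singleton_ne_empty _ (Multinerve.F_eq_empty_of_le_bot h)).elim
      · rw [M.simplex_vert_le (M.vx_mem_simplex v'), M.mem_simplex_vert_F] at h
        rw [M.vert_inj v v' h.1 h.2]
      · rw [M.simplex_vert_le (M.ex_mem_simplex e'), M.mem_simplex_edge_F] at h
        obtain ⟨h₁ | h₁, h₂⟩ := h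
        · rw [M.vert_inj v (G.lo e') (h₁.trans (M.vi_lo e').symm)
            (h₂.trans (h₁ ▸ (M.joined_lo e').symm))]
          exact .lo e'
        · rw [M.vert_inj v (G.hi e') (h₁.trans (M.vi_hi e').symm)
            (h₂.trans (h₁ ▸ (M.joined_hi e').symm))]
          exact .hi e'
    · rcases q with _ | v' | e'
      · exact (Finset.insert_ne_empty _ _ (Multinerve.F_eq_empty_of_le_bot h)).elim
      · rw [M.simplex_edge_le (M.vx_mem_simplex v'), M.mem_simplex_vert_F,
          M.mem_simplex_vert_F] at h
        -- Two consecutive indices cannot both equal the single index of a vertex.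
        omega
      · rw [M.simplex_edge_le (M.ex_mem_simplex e'), M.mem_simplex_edge_F,
          M.mem_simplex_edge_F] at h
        rw [M.edge_inj e e' (by omega) h.2]
  · intro h
    rcases h with _ | _ | e | e
    · exact Multinerve.bot_le' _
    · exact le_rfl
    · rw [M.simplex_vert_le (M.ex_mem_simplex e), M.mem_simplex_edge_F, M.vi_lo]
      exact ⟨Or.inl rfl, M.joined_lo e⟩
    · rw [M.simplex_vert_le (M.ex_mem_simplex e), M.mem_simplex_edge_F, M.vi_hi]
      exact ⟨Or.inr rfl, M.joined_hi e⟩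

/-- If `i` is the least index of a simplex, any other index must be `i + 1`, since members further
away are disjoint from `W i`. So a nonempty simplex is a vertex or an edge. -/
theorem simplex_surjective (M : MultinerveModel G W) : Function.Surjective M.simplex := by
  intro s
  obtain rfl | ⟨hF, x, hx, hs⟩ := s.eq_bot_or_eq_ofPoint
  · exact ⟨.empty, rfl⟩
  have hxs : x ∈ s.C := by rw [hs]; exact Multinerve.mem_C_ofPoint _ _
  clear hs
  have hmem := mem_iInter₂.1 hx
  have hi := s.F.min'_mem hF
  have hmin : ∀ j ∈ s.F, s.F.min' hF ≤ j := fun j hj => s.F.min'_le j hj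
  generalize s.F.min' hF = i at hi hmin
  have hsub : ∀ j ∈ s.F, j = i ∨ j = i + 1 := by
    intro j hj
    have h₁ := hmin j hj
    by_contra! h
    exact Set.disjoint_left.1 (M.disjoint i j (by omega)) (hmem i hi) (hmem j hj)
  by_cases hi' : i + 1 ∈ s.F
  · obtain ⟨e, rfl, he⟩ := M.edge_surj i x ⟨hmem _ hi, hmem _ hi'⟩
    refine ⟨.edge e, le_antisymm ((M.simplex_edge_le hxs).2 ⟨⟨hi, hi'⟩, he⟩) ?_⟩
    rw [Multinerve.le_iff_joinedIn hF hxs (M.ex_mem_simplex e)]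
    refine ⟨fun j hj => M.mem_simplex_edge_F.2 (hsub j hj),
      he.symm.mono (subset_iInter₂ fun j hj => ?_)⟩
    obtain rfl | rfl := hsub j hj
    exacts [inter_subset_left, inter_subset_right]
  · have hsub' : ∀ j ∈ s.F, j = i := fun j hj =>
      (hsub j hj).resolve_right (by rintro rfl; exact hi' hj)
    obtain ⟨v, rfl, hv⟩ := M.vert_surj i x (hmem _ hi)
    refine ⟨.vert v, le_antisymm ((M.simplex_vert_le hxs).2 ⟨hi, hv⟩) ?_⟩
    rw [Multinerve.le_iff_joinedIn hF hxs (M.vx_mem_simplex v)]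
    refine ⟨fun j hj => M.mem_simplex_vert_F.2 (hsub' j hj),
      hv.symm.mono (subset_iInter₂ fun j hj => ?_)⟩
    rw [hsub' j hj]

theorem nonempty_orderIso (M : MultinerveModel G W) : Nonempty (Multinerve W ≃o G.Face) :=
  ⟨(RelIso.ofSurjective (OrderEmbedding.ofMapLEIff M.simplex M.simplex_le)
    M.simplex_surjective).symm⟩

end MultinerveModel

/-! ### The abstract properties of a telescope -/

/-- The properties of a bounded telescope `f : X → ℝ` with critical values `A` that determine its
MultiNerve Mapper: over an interval with at most one critical value `u`, points can be moved into
the fibre over `u`, and the interval adds no connections between the points of that fibre. -/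
structure IsTelescopic {X : Type u} [TopologicalSpace X] (f : X → ℝ) (A : Set ℝ) : Prop where
  finite : A.Finite
  exists_gap : ∀ z ∈ range f, z ∉ A →
    ∃ s ∈ A, ∃ t ∈ A, s < z ∧ z < t ∧ Disjoint A (Ioo s t) ∧ Icc s t ⊆ range f
  exists_joinedIn : ∀ J : Set ℝ, J.OrdConnected → ∀ u ∈ J, J ∩ A ⊆ {u} → ∀ x ∈ f ⁻¹' J,
    ∃ y, f y = u ∧ JoinedIn (f ⁻¹' J) x y
  joinedIn_fibre : ∀ J : Set ℝ, J.OrdConnected → ∀ u ∈ J, J ∩ A ⊆ {u} → ∀ x y,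
    f x = u → f y = u → JoinedIn (f ⁻¹' J) x y → JoinedIn (f ⁻¹' {u}) x y

namespace IsTelescopic

variable {X : Type u} [TopologicalSpace X] {f : X → ℝ} {A : Set ℝ}

/-- Points over a smaller interval that are joined over a larger one are joined over the smaller
one. -/
theorem joinedIn_of_subset (h : IsTelescopic f A) {J K : Set ℝ} (hJ : J.OrdConnected)
    (hK : K.OrdConnected) (hJK : J ⊆ K) {u : ℝ} (hu : u ∈ J) (hKA : K ∩ A ⊆ {u}) {x y : X}
    (hx : f x ∈ J) (hy : f y ∈ J) (hxy : JoinedIn (f ⁻¹' K) x y) : JoinedIn (f ⁻¹' J) x y := by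
  have hJA : J ∩ A ⊆ {u} := (inter_subset_inter_left A hJK).trans hKA
  obtain ⟨x', hx', hxx'⟩ := h.exists_joinedIn J hJ u hu hJA x hx
  obtain ⟨y', hy', hyy'⟩ := h.exists_joinedIn J hJ u hu hJA y hy
  have hm : f ⁻¹' J ⊆ f ⁻¹' K := preimage_mono hJK
  have h' := h.joinedIn_fibre K hK u (hJK hu) hKA x' y' hx' hy'
    (((hxx'.mono hm).symm.trans hxy).trans (hyy'.mono hm))
  exact (hxx'.trans (h'.mono (preimage_mono (singleton_subset_iff.2 hu)))).trans hyy'.symm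

/-- The image is a finite union of closed intervals with critical endpoints. Compactness is what
later forces a gomic to be finite. -/
theorem isCompact_range (h : IsTelescopic f A) : IsCompact (range f) := by
  classical
  have hA := h.finite
  have : range f = ⋃ s ∈ A, ⋃ t ∈ A, if Icc s t ⊆ range f then Icc s t else ∅ := by
    ext z
    simp only [mem_iUnion]
    constructor
    · intro hz
      by_cases hzA : z ∈ A
      -- A critical value is covered by the degenerate interval `Icc z z`.
      · refine ⟨z, hzA, z, hzA, ?_⟩
        rw [if_pos (by rw [Icc_self]; exact singleton_subset_iff.2 hz)]
        exact ⟨le_rfl, le_rfl⟩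
      · obtain ⟨s, hs, t, ht, hsz, hzt, -, hst⟩ := h.exists_gap z hz hzA
        exact ⟨s, hs, t, ht, by rw [if_pos hst]; exact ⟨hsz.le, hzt.le⟩⟩
    · rintro ⟨s, -, t, -, hz⟩
      split_ifs at hz with hst
      · exact hst hz
      · exact hz.elim
  rw [this]
  refine hA.isCompact_biUnion fun s _ => hA.isCompact_biUnion fun t _ => ?_
  split_ifs
  · exact isCompact_Icc
  · exact isCompact_empty

/-- The trace of an interval on the image is an interval if it has at most one critical value. -/
theorem ordConnected_inter_range (h : IsTelescopic f A) {I : Set ℝ} (hI : I.OrdConnected)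
    (hIA : (I ∩ range f ∩ A).Subsingleton) : (I ∩ range f).OrdConnected := by
  refine ⟨fun x hx y hy w hw => ⟨hI.out hx.1 hy.1 hw, ?_⟩⟩
  by_contra hwr
  -- A missing value `w` between `x` and `y` would have critical values of the image on both sides,
  -- because the image can only break off at a critical value. Both would lie in `I`.
  have key₁ : ∃ t ∈ A, x ≤ t ∧ t < w ∧ t ∈ range f := by
    by_cases hxA : x ∈ A
    · exact ⟨x, hxA, le_rfl, lt_of_le_of_ne hw.1 (by rintro rfl; exact hwr hx.2), hx.2⟩
    · obtain ⟨s, hs, t, ht, hsx, hxt, -, hst⟩ := h.exists_gap x hx.2 hxA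
      refine ⟨t, ht, hxt.le, ?_, hst ⟨(hsx.trans hxt).le, le_rfl⟩⟩
      by_contra! hwt
      exact hwr (hst ⟨hsx.le.trans hw.1, hwt⟩)
  have key₂ : ∃ t ∈ A, w < t ∧ t ≤ y ∧ t ∈ range f := by
    by_cases hyA : y ∈ A
    · exact ⟨y, hyA, lt_of_le_of_ne hw.2 (by rintro rfl; exact hwr hy.2), le_rfl, hy.2⟩
    · obtain ⟨s, hs, t, ht, hsy, hyt, -, hst⟩ := h.exists_gap y hy.2 hyA
      refine ⟨s, hs, ?_, hsy.le, hst ⟨le_rfl, (hsy.trans hyt).le⟩⟩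
      by_contra! hws
      exact hwr (hst ⟨hws, hw.2.trans hyt.le⟩)
  obtain ⟨t, htA, hxt, htw, htr⟩ := key₁
  obtain ⟨t', htA', hwt', hty', htr'⟩ := key₂
  have htt := hIA
    ⟨⟨hI.out hx.1 hy.1 ⟨hxt, htw.le.trans hw.2⟩, htr⟩, htA⟩
    ⟨⟨hI.out hx.1 hy.1 ⟨hw.1.trans hwt'.le, hty'⟩, htr'⟩, htA'⟩
  linarith

end IsTelescopic

/-! ### Nodes and edges of the combinatorial Reeb graph -/

namespace ReebNode

variable {X : Type u} [TopologicalSpace X] {f : X → ℝ} {A : Set ℝ}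

/-- The node through a point of a critical level set. -/
def ofPoint (x : X) (hx : f x ∈ A) : ReebNode f A := ⟨reebProj f x, hx⟩

theorem mem_carrier_ofPoint (x : X) (hx : f x ∈ A) : x ∈ (ofPoint x hx : ReebNode f A).carrier :=
  rfl

theorem carrier_nonempty (p : ReebNode f A) : p.carrier.Nonempty := by
  obtain ⟨⟨x⟩, hx⟩ := p
  exact ⟨x, rfl⟩

/-- A point of the component that a node represents. -/
noncomputable def rep (p : ReebNode f A) : X := p.carrier_nonempty.choose

theorem rep_mem_carrier (p : ReebNode f A) : p.rep ∈ p.carrier := p.carrier_nonempty.choose_spec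

theorem height_eq_of_mem_carrier {p : ReebNode f A} {x : X} (hx : x ∈ p.carrier) :
    f x = p.height :=
  congrArg (reebMap f) (show reebProj f x = p.1 from hx)

theorem map_rep (p : ReebNode f A) : f p.rep = p.height :=
  height_eq_of_mem_carrier p.rep_mem_carrier

theorem height_mem (p : ReebNode f A) : p.height ∈ A := p.2

theorem height_mem_range (p : ReebNode f A) : p.height ∈ range f := ⟨p.rep, p.map_rep⟩

theorem joinedIn_of_mem_carrier {p : ReebNode f A} {x y : X} (hx : x ∈ p.carrier)
    (hy : y ∈ p.carrier) : JoinedIn (f ⁻¹' {p.height}) x y := by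
  have h : reebProj f x = reebProj f y := (show _ = p.1 from hx).trans (show _ = p.1 from hy).symm
  have h' := (Quotient.exact h).2
  rwa [height_eq_of_mem_carrier hx] at h'

theorem eq_of_joinedIn {p q : ReebNode f A} {x y : X} (hx : x ∈ p.carrier) (hy : y ∈ q.carrier)
    (h : JoinedIn (f ⁻¹' {p.height}) x y) : p = q := by
  apply Subtype.ext
  rw [← show reebProj f x = p.1 from hx, ← show reebProj f y = q.1 from hy]
  refine Quotient.sound ⟨?_, ?_⟩
  · rw [height_eq_of_mem_carrier hx]; exact h.target_mem.symm
  · rwa [height_eq_of_mem_carrier hx]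

end ReebNode

namespace ReebEdge

variable {X : Type u} [TopologicalSpace X] {f : X → ℝ} {A : Set ℝ}

theorem map_mem_Ioo (e : ReebEdge f A) {x : X} (hx : x ∈ e.comp) :
    f x ∈ Ioo e.lo.height e.hi.height :=
  e.isCC.subset hx

theorem Ico_inter_subset (e : ReebEdge f A) :
    Ico e.lo.height e.hi.height ∩ A ⊆ {e.lo.height} := by
  rintro z ⟨hz, hzA⟩
  by_contra hne
  exact disjoint_left.1 e.consecutive hzA ⟨lt_of_le_of_ne hz.1 (Ne.symm hne), hz.2⟩

theorem Ioc_inter_subset (e : ReebEdge f A) :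
    Ioc e.lo.height e.hi.height ∩ A ⊆ {e.hi.height} := by
  rintro z ⟨hz, hzA⟩
  by_contra hne
  exact disjoint_left.1 e.consecutive hzA ⟨hz.1, lt_of_le_of_ne hz.2 hne⟩

theorem joinedIn_Ico (e : ReebEdge f A) {x y : X} (hx : x ∈ e.lo.carrier) (hy : y ∈ e.comp) :
    JoinedIn (f ⁻¹' Ico e.lo.height e.hi.height) x y := by
  obtain ⟨x', hx', y', hy', h⟩ := e.joined_lo
  refine ((ReebNode.joinedIn_of_mem_carrier hx hx').mono (preimage_mono ?_)).trans
    (h.trans ((e.isCC.joinedIn hy' hy).mono (preimage_mono Ioo_subset_Ico_self)))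
  exact singleton_subset_iff.2 ⟨le_rfl, e.lt⟩

theorem joinedIn_Ioc (e : ReebEdge f A) {x y : X} (hx : x ∈ e.hi.carrier) (hy : y ∈ e.comp) :
    JoinedIn (f ⁻¹' Ioc e.lo.height e.hi.height) x y := by
  obtain ⟨x', hx', y', hy', h⟩ := e.joined_hi
  refine ((ReebNode.joinedIn_of_mem_carrier hx hx').mono (preimage_mono ?_)).trans
    (h.trans ((e.isCC.joinedIn hy' hy).mono (preimage_mono Ioo_subset_Ioc_self)))
  exact singleton_subset_iff.2 ⟨e.lt, le_rfl⟩

/-- There is no critical value below the open edge, so any height `z` there may serve as `u` in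
`exists_joinedIn`. -/
theorem exists_mem_comp (h : IsTelescopic f A) (e : ReebEdge f A) {z : ℝ}
    (hz : z ∈ Ioo e.lo.height e.hi.height) : ∃ x ∈ e.comp, f x = z := by
  obtain ⟨x, hx⟩ := e.isCC.nonempty
  obtain ⟨y, hy, hxy⟩ := h.exists_joinedIn _ ordConnected_Ioo z hz
    (by rw [e.consecutive.symm.inter_eq]; exact empty_subset _) x (e.isCC.subset hx)
  refine ⟨y, ?_, hy⟩
  rw [e.isCC.eq_pathComponentIn hx]
  exact hxy

theorem Icc_subset_range (h : IsTelescopic f A) (e : ReebEdge f A) :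
    Icc e.lo.height e.hi.height ⊆ range f := by
  rintro z ⟨hz₁, hz₂⟩
  obtain rfl | hz₁ := hz₁.eq_or_lt
  · exact e.lo.height_mem_range
  obtain rfl | hz₂ := hz₂.eq_or_lt
  · exact e.hi.height_mem_range
  obtain ⟨x, -, hx⟩ := e.exists_mem_comp h ⟨hz₁, hz₂⟩
  exact ⟨x, hx⟩

/-- The two end nodes are found by sliding `x` down in `Ico s t` and up in `Ioc s t`; each half-open
interval has just one critical value. -/
theorem exists_mem (h : IsTelescopic f A) (x : X) (hx : f x ∉ A) :
    ∃ e : ReebEdge f A, x ∈ e.comp := by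
  obtain ⟨s, hs, t, ht, hsx, hxt, hst, -⟩ := h.exists_gap _ ⟨x, rfl⟩ hx
  have hne : ∀ z ∈ A, s < z → z < t → False := fun z hz h₁ h₂ => disjoint_left.1 hst hz ⟨h₁, h₂⟩
  obtain ⟨y, rfl, hxy⟩ := h.exists_joinedIn (Ico s t) ordConnected_Ico s ⟨le_rfl, hsx.trans hxt⟩
    (fun z hz => hz.1.1.eq_or_lt.elim Eq.symm fun h => (hne z hz.2 h hz.1.2).elim) x ⟨hsx.le, hxt⟩
  obtain ⟨y', rfl, hxy'⟩ := h.exists_joinedIn (Ioc (f y) t) ordConnected_Ioc t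
    ⟨hsx.trans hxt, le_rfl⟩
    (fun z hz => hz.1.2.eq_or_lt.elim id fun h => (hne z hz.2 hz.1.1 h).elim) x ⟨hsx, hxt.le⟩
  have hxm : x ∈ f ⁻¹' Ioo (f y) (f y') := ⟨hsx, hxt⟩
  exact ⟨{  lo := .ofPoint y hs
            hi := .ofPoint y' ht
            comp := pathComponentIn (f ⁻¹' Ioo (f y) (f y')) x
            lt := hsx.trans hxt
            consecutive := hst
            isCC := isCC_pathComponentIn hxm
            joined_lo := ⟨y, rfl, x, mem_pathComponentIn_self hxm, hxy.symm⟩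
            joined_hi := ⟨y', rfl, x, mem_pathComponentIn_self hxm, hxy'.symm⟩ },
    mem_pathComponentIn_self hxm⟩

theorem subset_Ioo (e : ReebEdge f A) {J : Set ℝ} (hJ : J.OrdConnected) (hJA : Disjoint J A)
    {z : ℝ} (hz : z ∈ J) (hze : z ∈ Ioo e.lo.height e.hi.height) :
    J ⊆ Ioo e.lo.height e.hi.height := by
  intro w hw
  by_contra hne
  rw [mem_Ioo, not_and_or, not_lt, not_lt] at hne
  obtain h | h := hne
  · exact disjoint_left.1 hJA (hJ.out hw hz ⟨h, hze.1.le⟩) e.lo.height_mem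
  · exact disjoint_left.1 hJA (hJ.out hz hw ⟨hze.2.le, h⟩) e.hi.height_mem

/-- Two edges that are joined over an interval without critical values are equal. -/
theorem eq_of_joinedIn (h : IsTelescopic f A) {e e' : ReebEdge f A} {J : Set ℝ}
    (hJ : J.OrdConnected) (hJA : Disjoint J A) {x x' : X} (hx : x ∈ e.comp) (hx' : x' ∈ e'.comp)
    (hxx' : JoinedIn (f ⁻¹' J) x x') : e = e' := by
  have h₁ := e.subset_Ioo hJ hJA hxx'.source_mem (e.map_mem_Ioo hx) hxx'.target_mem
  have h₂ := e'.map_mem_Ioo hx'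
  have hA : ∀ (e : ReebEdge f A), ∀ z ∈ A, ¬ (e.lo.height < z ∧ z < e.hi.height) :=
    fun e z hz hz' => disjoint_left.1 e.consecutive hz hz'
  -- Both gaps contain `f x'`. If their lower ends differed, the larger one would be a critical
  -- value inside the other gap; the upper ends are treated likewise.
  have hlo : e.lo.height = e'.lo.height := by
    have h₃ := hA e _ e'.lo.height_mem
    have h₄ := hA e' _ e.lo.height_mem
    have := h₁.1; have := h₁.2; have := h₂.1; have := h₂.2
    by_contra hne
    obtain hlt | hlt := lt_or_gt_of_ne hne
    · exact h₃ ⟨hlt, by linarith⟩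
    · exact h₄ ⟨hlt, by linarith⟩
  have hhi : e.hi.height = e'.hi.height := by
    have h₃ := hA e _ e'.hi.height_mem
    have h₄ := hA e' _ e.hi.height_mem
    have := h₁.1; have := h₁.2; have := h₂.1; have := h₂.2
    by_contra hne
    obtain hlt | hlt := lt_or_gt_of_ne hne
    · exact h₄ ⟨by linarith, hlt⟩
    · exact h₃ ⟨by linarith, hlt⟩
  have hj : JoinedIn (f ⁻¹' Ioo e.lo.height e.hi.height) x x' :=
    hxx'.mono (preimage_mono (e.subset_Ioo hJ hJA hxx'.source_mem (e.map_mem_Ioo hx)))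
  -- Both lower nodes are joined over `Ico`, whose only critical value is the common lower height;
  -- `joinedIn_fibre` moves the connection into that fibre.
  have hlo' : e.lo = e'.lo := by
    have ha := e.joinedIn_Ico e.lo.rep_mem_carrier hx
    have hb := e'.joinedIn_Ico e'.lo.rep_mem_carrier hx'
    rw [← hlo, ← hhi] at hb
    exact ReebNode.eq_of_joinedIn e.lo.rep_mem_carrier e'.lo.rep_mem_carrier
      (h.joinedIn_fibre _ ordConnected_Ico _ ⟨le_rfl, e.lt⟩ e.Ico_inter_subset _ _ e.lo.map_rep
        (e'.lo.map_rep.trans hlo.symm)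
        ((ha.trans (hj.mono (preimage_mono Ioo_subset_Ico_self))).trans hb.symm))
  have hhi' : e.hi = e'.hi := by
    have ha := e.joinedIn_Ioc e.hi.rep_mem_carrier hx
    have hb := e'.joinedIn_Ioc e'.hi.rep_mem_carrier hx'
    rw [← hlo, ← hhi] at hb
    exact ReebNode.eq_of_joinedIn e.hi.rep_mem_carrier e'.hi.rep_mem_carrier
      (h.joinedIn_fibre _ ordConnected_Ioc _ ⟨e.lt, le_rfl⟩ e.Ioc_inter_subset _ _ e.hi.map_rep
        (e'.hi.map_rep.trans hhi.symm)
        ((ha.trans (hj.mono (preimage_mono Ioo_subset_Ioc_self))).trans hb.symm))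
  have hcomp : e.comp = e'.comp := by
    rw [e.isCC.eq_pathComponentIn hx, e'.isCC.eq_pathComponentIn hx', ← hlo, ← hhi]
    exact (pathComponentIn_congr hj).symm
  cases e; cases e'
  obtain rfl : _ = _ := hlo'
  obtain rfl : _ = _ := hhi'
  obtain rfl : _ = _ := hcomp
  rfl

end ReebEdge

/-! ### Telescopes have the abstract properties -/

/-- A retraction of the part over `J` onto the fibre over `u` shows that points of this fibre which
are joined over `J` are joined in the fibre. -/
theorem joinedIn_fibre_of_retraction {X W : Type*} [TopologicalSpace X] [TopologicalSpace W]
    {f : X → ℝ} {J : Set ℝ} {u : ℝ} {ρ : X → W} (hρ : ContinuousOn ρ (f ⁻¹' J)) {i : W → X}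
    (hi : Continuous i) (hu : ∀ w, f (i w) = u) (hiρ : ∀ x, f x = u → i (ρ x) = x) {x y : X}
    (hx : f x = u) (hy : f y = u) (h : JoinedIn (f ⁻¹' J) x y) : JoinedIn (f ⁻¹' {u}) x y := by
  have h' := (h.map_continuousOn hρ).map hi
  rw [hiρ x hx, hiρ y hy] at h'
  refine h'.mono ?_
  rintro _ ⟨w, -, rfl⟩
  exact hu w

namespace Telescope

variable (T : Telescope.{u})

/-- The quotient map onto a telescope. -/
def toSpace (p : T.Pieces) : T.Space := Quot.mk T.Glue p

theorem continuous_toSpace : Continuous T.toSpace := continuous_quot_mk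

theorem toSpace_surjective : Function.Surjective T.toSpace := Quot.mk_surjective

@[simp] theorem proj_toSpace_inl (k : Fin (T.n + 1)) (p : T.Y k × T.strip k) :
    T.proj (T.toSpace (Sum.inl ⟨k, p⟩)) = p.2 := rfl

@[simp] theorem proj_toSpace_inr (i : Fin T.n) (x : T.X i) :
    T.proj (T.toSpace (Sum.inr ⟨i, x⟩)) = T.a i := rfl

theorem continuous_proj : Continuous T.proj := by
  refine continuous_quot_lift _ (Continuous.sumElim (continuous_sigma fun k => ?_)
    (continuous_sigma fun i => (continuous_const : Continuous fun _ => T.a i)))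
  exact continuous_subtype_val.comp continuous_snd

theorem toSpace_succ (i : Fin T.n) (y : T.Y i.succ) (t : T.strip i.succ) (ht : (t : ℝ) = T.a i) :
    T.toSpace (Sum.inl ⟨i.succ, y, t⟩) = T.toSpace (Sum.inr ⟨i, T.φ i y⟩) := by
  obtain rfl : t = ⟨T.a i, T.mem_strip_succ i⟩ := Subtype.ext ht
  exact Quot.sound (.bottom i y)

theorem toSpace_castSucc (i : Fin T.n) (y : T.Y i.castSucc) (t : T.strip i.castSucc)
    (ht : (t : ℝ) = T.a i) :
    T.toSpace (Sum.inl ⟨i.castSucc, y, t⟩) = T.toSpace (Sum.inr ⟨i, T.ψ i y⟩) := by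
  obtain rfl : t = ⟨T.a i, T.mem_strip_castSucc i⟩ := Subtype.ext ht
  exact Quot.sound (.top i y)

/-- Any cylinder other than the two adjacent to `a i` is separated from this height by another
critical value. -/
theorem eq_succ_or_eq_castSucc {k : Fin (T.n + 1)} {i : Fin T.n} (h : T.a i ∈ T.strip k) :
    k = i.succ ∨ k = i.castSucc := by
  by_contra! hne
  simp only [ne_eq, Fin.ext_iff, Fin.val_succ, Fin.val_castSucc] at hne
  have hi := i.2
  have hk := k.2
  obtain hlt | hlt := lt_or_ge (i : ℕ) k
  · have h₁ := (h ⟨i + 1, by omega⟩).1 (by simp only [Fin.lt_def, Fin.val_castSucc]; omega)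
    have h₂ := T.strictMono_a.le_iff_le.1 h₁
    change (i : ℕ) + 1 ≤ i at h₂
    omega
  · have h₁ := (h ⟨k, by omega⟩).2 (by simp)
    have h₂ := T.strictMono_a.le_iff_le.1 h₁
    simp only [Fin.le_def] at h₂
    omega

theorem exists_eq_of_proj_eq {x : T.Space} {i : Fin T.n} (h : T.proj x = T.a i) :
    ∃ x₀, x = T.toSpace (Sum.inr ⟨i, x₀⟩) := by
  obtain ⟨⟨k, y, t⟩ | ⟨j, x₀⟩, rfl⟩ := T.toSpace_surjective x
  · have ht : (t : ℝ) = T.a i := h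
    obtain rfl | rfl := T.eq_succ_or_eq_castSucc (ht ▸ t.2)
    exacts [⟨_, T.toSpace_succ i y t ht⟩, ⟨_, T.toSpace_castSucc i y t ht⟩]
  · obtain rfl := T.strictMono_a.injective h
    exact ⟨x₀, rfl⟩

theorem finite_crit : T.crit.Finite := finite_range T.a

theorem ordConnected_strip (k : Fin (T.n + 1)) : (T.strip k).OrdConnected :=
  ⟨fun _ hx _ hy _ hw i =>
    ⟨fun h => ((hx i).1 h).trans hw.1, fun h => hw.2.trans ((hy i).2 h)⟩⟩

/-- The heights available in both the cylinder and `J` form a convex set, so the vertical segment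
stays over `J`. -/
theorem joinedIn_vertical {k : Fin (T.n + 1)} (y : T.Y k) (t t' : T.strip k) {J : Set ℝ}
    (hJ : J.OrdConnected) (ht : (t : ℝ) ∈ J) (ht' : (t' : ℝ) ∈ J) :
    JoinedIn (T.proj ⁻¹' J) (T.toSpace (Sum.inl ⟨k, y, t⟩)) (T.toSpace (Sum.inl ⟨k, y, t'⟩)) := by
  have hc : Convex ℝ (T.strip k ∩ J) := ((T.ordConnected_strip k).inter hJ).convex
  have h := (hc.isPathConnected ⟨t, t.2, ht⟩).joinedIn t ⟨t.2, ht⟩ t' ⟨t'.2, ht'⟩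
  let F : ↥(T.strip k ∩ J) → T.Space := fun r => T.toSpace (Sum.inl ⟨k, y, ⟨r, r.2.1⟩⟩)
  have hF : Continuous F := by
    refine T.continuous_toSpace.comp (continuous_inl.comp (continuous_sigmaMk.comp ?_))
    exact continuous_const.prodMk (continuous_subtype_val.subtype_mk _)
  refine ((joinedIn_univ.2 h.joined_subtype).map hF).mono ?_
  rintro _ ⟨r, -, rfl⟩
  exact r.2.2

/-- A continuous map on the pieces that respects the gluing over an open set `O` descends to the
part of the telescope over `O`. -/
theorem exists_continuousOn_lift {W : Type*} [TopologicalSpace W] (w : W) {g : T.Pieces → W}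
    (hg : Continuous g) {O : Set ℝ} (hO : IsOpen O)
    (hgO : ∀ p q, T.Glue p q → T.proj (T.toSpace p) ∈ O → g p = g q) :
    ∃ ρ : T.Space → W, ContinuousOn ρ (T.proj ⁻¹' O) ∧
      ∀ p, T.proj (T.toSpace p) ∈ O → ρ (T.toSpace p) = g p := by
  classical
  -- The value `w` away from `O` is arbitrary: it makes the map respect every gluing, and continuity
  -- is claimed only over `O`.
  let ρ : T.Space → W := Quot.lift (fun p => if T.proj (T.toSpace p) ∈ O then g p else w) (by
    intro p q h
    have hpq : T.toSpace p = T.toSpace q := Quot.sound h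
    change (if _ then _ else _) = (if _ then _ else _)
    rw [← hpq]
    split_ifs with hp
    · exact hgO p q h hp
    · rfl)
  have hρ : ∀ p, T.proj (T.toSpace p) ∈ O → ρ (T.toSpace p) = g p := fun p hp => if_pos hp
  refine ⟨ρ, ?_, hρ⟩
  rw [continuousOn_open_iff (hO.preimage T.continuous_proj)]
  intro V hV
  have hq : IsQuotientMap T.toSpace := isQuotientMap_quot_mk
  rw [← hq.isOpen_preimage]
  have : T.toSpace ⁻¹' (T.proj ⁻¹' O ∩ ρ ⁻¹' V) = T.toSpace ⁻¹' (T.proj ⁻¹' O) ∩ g ⁻¹' V := by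
    ext p
    refine and_congr_right fun hp => ?_
    rw [mem_preimage, mem_preimage, hρ p hp]
  rw [this]
  exact ((hO.preimage T.continuous_proj).preimage T.continuous_toSpace).inter (hV.preimage hg)

open Classical in
/-- The map of the pieces to the critical slice `X i`, constant on the pieces away from it. -/
noncomputable def toSlice (i : Fin T.n) (x₀ : T.X i) : T.Pieces → T.X i :=
  Sum.elim
    (fun p => if h : p.1 = i.castSucc then T.ψ i (h ▸ p.2.1) else
      if h : p.1 = i.succ then T.φ i (h ▸ p.2.1) else x₀)
    (fun p => if h : p.1 = i then h ▸ p.2 else x₀)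

theorem continuous_toSlice (i : Fin T.n) (x₀ : T.X i) : Continuous (T.toSlice i x₀) := by
  refine Continuous.sumElim (continuous_sigma fun k => ?_) (continuous_sigma fun j => ?_)
  · by_cases h₁ : k = i.castSucc
    · subst h₁
      simp only [dite_true]
      exact (T.ψ i).continuous.comp continuous_fst
    · by_cases h₂ : k = i.succ
      · subst h₂
        simp only [h₁, dite_true, dite_false]
        exact (T.φ i).continuous.comp continuous_fst
      · simp only [h₁, h₂, dite_false]
        exact continuous_const
  · by_cases h₁ : j = i
    · subst h₁
      simp only [dite_true]
      exact continuous_id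
    · simp only [h₁, dite_false]
      exact continuous_const

/-- Over `J` only the cylinders adjacent to `X i` are glued to a slice, and only to `X i`; the
attaching maps collapse them onto it. -/
theorem joinedIn_critical (i : Fin T.n) {J : Set ℝ} (hi : T.a i ∈ J)
    (hJA : J ∩ T.crit ⊆ {T.a i}) {x y : T.Space} (hx : T.proj x = T.a i) (hy : T.proj y = T.a i)
    (h : JoinedIn (T.proj ⁻¹' J) x y) : JoinedIn (T.proj ⁻¹' {T.a i}) x y := by
  obtain ⟨x₀, rfl⟩ := T.exists_eq_of_proj_eq hx
  -- All heights except the other critical values: an open set containing `J`, over which the only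
  -- gluing is to the slice `X i`.
  let O : Set ℝ := (T.a '' {i}ᶜ)ᶜ
  have hO : IsOpen O := ((toFinite _).isClosed).isOpen_compl
  have hJO : J ⊆ O := by
    rintro _ hz ⟨j, hj, rfl⟩
    exact hj (T.strictMono_a.injective (hJA ⟨hz, j, rfl⟩))
  have hOi : ∀ j, T.a j ∈ O → j = i := fun j hj => by
    by_contra hne
    exact hj ⟨j, hne, rfl⟩
  have hne : i.succ ≠ i.castSucc := by simp [Fin.ext_iff]
  obtain ⟨ρ, hρ, hρg⟩ := T.exists_continuousOn_lift x₀ (T.continuous_toSlice i x₀) hO (by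
    rintro _ _ (⟨j, y⟩ | ⟨j, y⟩) hp
    · obtain rfl := hOi j hp
      simp [toSlice, hne]
    · obtain rfl := hOi j hp
      simp [toSlice])
  refine joinedIn_fibre_of_retraction (hρ.mono (preimage_mono hJO))
    (i := fun x => T.toSpace (Sum.inr ⟨i, x⟩))
    (T.continuous_toSpace.comp (continuous_inr.comp continuous_sigmaMk)) (fun _ => rfl) ?_ hx hy h
  intro z hz
  obtain ⟨z₀, rfl⟩ := T.exists_eq_of_proj_eq hz
  rw [hρg (Sum.inr ⟨i, z₀⟩) (hJO hi)]
  simp [toSlice]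

open Classical in
/-- The map of the pieces to `Y k`, constant on the pieces other than the cylinder over `Y k`. -/
noncomputable def toBase (k : Fin (T.n + 1)) (y₀ : T.Y k) : T.Pieces → T.Y k :=
  Sum.elim (fun p => if h : p.1 = k then h ▸ p.2.1 else y₀) (fun _ => y₀)

theorem continuous_toBase (k : Fin (T.n + 1)) (y₀ : T.Y k) : Continuous (T.toBase k y₀) := by
  refine Continuous.sumElim (continuous_sigma fun j => ?_) continuous_const
  by_cases h₁ : j = k
  · subst h₁
    simp only [dite_true]
    exact continuous_fst
  · simp only [h₁, dite_false]
    exact continuous_const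

/-- For `k < k'` the critical value numbered `k` bounds one strip from above and the other from
below, so it is their only possible common height. -/
theorem strip_injOn_compl_crit {k k' : Fin (T.n + 1)} {t : ℝ} (ht : t ∈ T.strip k)
    (ht' : t ∈ T.strip k') (htA : t ∉ T.crit) : k = k' := by
  have key : ∀ k k' : Fin (T.n + 1), t ∈ T.strip k → t ∈ T.strip k' → ¬ k < k' := by
    intro k k' ht ht' hlt
    have hk := k'.2
    rw [Fin.lt_def] at hlt
    let j : Fin T.n := ⟨k, by omega⟩
    have h₁ := (ht j).2 (by simp [j])
    have h₂ := (ht' j).1 (by simp only [j, Fin.lt_def, Fin.val_castSucc]; exact hlt)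
    exact htA ⟨j, le_antisymm h₂ h₁⟩
  exact le_antisymm (not_lt.1 (key _ _ ht' ht)) (not_lt.1 (key _ _ ht ht'))

/-- Nothing is glued away from the critical values, so projecting the cylinder of `x` to its base
and sending the other cylinders to a constant is continuous over `J`. The whole fibre over `u` lies
in the cylinder of `x`. -/
theorem joinedIn_regular {u : ℝ} (hu : u ∉ T.crit) {J : Set ℝ} (hJA : Disjoint J T.crit)
    {x y : T.Space} (hx : T.proj x = u) (hy : T.proj y = u) (h : JoinedIn (T.proj ⁻¹' J) x y) :
    JoinedIn (T.proj ⁻¹' {u}) x y := by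
  obtain ⟨⟨k, y₀, t⟩ | ⟨j, x₀⟩, rfl⟩ := T.toSpace_surjective x
  swap
  · exact (hu ⟨j, hx⟩).elim
  have ht : (t : ℝ) = u := hx
  have hO : IsOpen T.critᶜ := T.finite_crit.isClosed.isOpen_compl
  obtain ⟨ρ, hρ, hρg⟩ := T.exists_continuousOn_lift y₀ (T.continuous_toBase k y₀) hO (by
    rintro _ _ (⟨j, y⟩ | ⟨j, y⟩) hp
    · exact (hp ⟨j, rfl⟩).elim
    · exact (hp ⟨j, rfl⟩).elim)
  refine joinedIn_fibre_of_retraction (hρ.mono (preimage_mono hJA.subset_compl_right))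
    (i := fun y => T.toSpace (Sum.inl ⟨k, y, t⟩)) (T.continuous_toSpace.comp
      (continuous_inl.comp (continuous_sigmaMk.comp (continuous_id.prodMk continuous_const))))
    (fun _ => ht) ?_ hx hy h
  intro z hz
  obtain ⟨⟨k', y', t'⟩ | ⟨j, x₀⟩, rfl⟩ := T.toSpace_surjective z
  swap
  · exact (hu ⟨j, hz⟩).elim
  have ht' : (t' : ℝ) = u := hz
  obtain rfl := T.strip_injOn_compl_crit (ht ▸ t.2) (ht' ▸ t'.2) hu
  obtain rfl : t = t' := Subtype.ext (ht.trans ht'.symm)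
  rw [hρg _ (by rw [hz]; exact hu)]
  simp [toBase]

/-- A noncritical value is attained in a cylinder that is neither the first nor the last, as these
are empty. It is bounded by two consecutive critical values, and one vertical line fills the closed
interval between them. -/
theorem exists_gap (hbot : IsEmpty (T.Y 0)) (htop : IsEmpty (T.Y (Fin.last T.n))) {z : ℝ}
    (hz : z ∈ range T.proj) (hzA : z ∉ T.crit) :
    ∃ s ∈ T.crit, ∃ t ∈ T.crit, s < z ∧ z < t ∧ Disjoint T.crit (Ioo s t) ∧
      Icc s t ⊆ range T.proj := by
  obtain ⟨x, rfl⟩ := hz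
  obtain ⟨⟨k, y, t⟩ | ⟨j, x₀⟩, rfl⟩ := T.toSpace_surjective x
  swap
  · exact (hzA ⟨j, rfl⟩).elim
  rw [proj_toSpace_inl] at hzA ⊢
  obtain rfl | ⟨i, rfl⟩ := k.eq_zero_or_eq_succ
  · exact hbot.elim y
  obtain hk | ⟨j, hj⟩ := i.succ.eq_castSucc_or_eq_last.symm
  · exact (hk ▸ htop).elim y
  rw [Fin.ext_iff, Fin.val_succ, Fin.val_castSucc] at hj
  have h₁ := (t.2 i).1 (by simp [Fin.lt_def])
  have h₂ := (t.2 j).2 (by simp only [Fin.le_def, Fin.val_succ, Fin.val_castSucc]; omega)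
  refine ⟨T.a i, ⟨i, rfl⟩, T.a j, ⟨j, rfl⟩, lt_of_le_of_ne h₁ fun h => hzA ⟨i, h⟩,
    lt_of_le_of_ne h₂ fun h => hzA ⟨j, h.symm⟩, ?_, ?_⟩
  · rw [disjoint_left]
    rintro _ ⟨m, rfl⟩ hm
    have h₃ := T.strictMono_a.lt_iff_lt.1 hm.1
    have h₄ := T.strictMono_a.lt_iff_lt.1 hm.2
    rw [Fin.lt_def] at h₃ h₄
    omega
  · intro w hw
    refine ⟨T.toSpace (Sum.inl ⟨i.succ, y, w, fun m => ⟨fun hm => ?_, fun hm => ?_⟩⟩), rfl⟩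
    · refine (T.strictMono_a.monotone ?_).trans hw.1
      simp only [Fin.lt_def, Fin.le_def, Fin.val_succ, Fin.val_castSucc] at hm ⊢
      omega
    · refine hw.2.trans (T.strictMono_a.monotone ?_)
      simp only [Fin.le_def, Fin.val_succ, Fin.val_castSucc] at hm ⊢
      omega

theorem exists_joinedIn {J : Set ℝ} (hJ : J.OrdConnected) {u : ℝ} (hu : u ∈ J)
    (hJA : J ∩ T.crit ⊆ {u}) {x : T.Space} (hx : T.proj x ∈ J) :
    ∃ y, T.proj y = u ∧ JoinedIn (T.proj ⁻¹' J) x y := by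
  by_cases hxu : T.proj x = u
  · exact ⟨x, hxu, JoinedIn.refl hx⟩
  obtain ⟨⟨k, y, t⟩ | ⟨j, x₀⟩, rfl⟩ := T.toSpace_surjective x
  swap
  · exact (hxu (hJA ⟨hx, j, rfl⟩)).elim
  rw [proj_toSpace_inl] at hxu hx
  -- A critical value separating `u` from the height of the point would lie in `J` and differ from
  -- `u`.
  have hus : u ∈ T.strip k := by
    intro i
    refine ⟨fun hi => ?_, fun hi => ?_⟩
    · by_contra! hlt
      exact hlt.ne' (hJA ⟨hJ.out hu hx ⟨hlt.le, (t.2 i).1 hi⟩, i, rfl⟩)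
    · by_contra! hlt
      exact hlt.ne (hJA ⟨hJ.out hx hu ⟨(t.2 i).2 hi, hlt.le⟩, i, rfl⟩)
  exact ⟨T.toSpace (Sum.inl ⟨k, y, u, hus⟩), rfl, T.joinedIn_vertical y t ⟨u, hus⟩ hJ hx hu⟩

theorem isTelescopic (hbot : IsEmpty (T.Y 0)) (htop : IsEmpty (T.Y (Fin.last T.n))) :
    IsTelescopic T.proj T.crit where
  finite := T.finite_crit
  exists_gap _ hz hzA := T.exists_gap hbot htop hz hzA
  exists_joinedIn _ hJ _ hu hJA _ hx := T.exists_joinedIn hJ hu hJA hx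
  joinedIn_fibre J hJ u hu hJA x y hx hy h := by
    by_cases huA : u ∈ T.crit
    · obtain ⟨i, rfl⟩ := huA
      exact T.joinedIn_critical i hu hJA hx hy h
    · refine T.joinedIn_regular huA (disjoint_left.2 fun z hz hzA => huA ?_) hx hy h
      rwa [← show z = u from hJA ⟨hz, hzA⟩]

end Telescope

/-! ### Endpoints in subdivided and split multigraphs -/

namespace Multigraph

variable (G : Multigraph.{u, v})

theorem subdivide_hi_last (k : G.Edge → ℕ) (e : G.Edge) :
    (G.subdivide k).hi ⟨e, Fin.last (k e)⟩ = Sum.inl (G.hi e) :=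
  Fin.lastCases_last (motive := fun _ => G.Vert ⊕ (Σ e : G.Edge, Fin (k e)))

theorem subdivide_hi_castSucc (k : G.Edge → ℕ) (e : G.Edge) (j : Fin (k e)) :
    (G.subdivide k).hi ⟨e, j.castSucc⟩ = Sum.inr ⟨e, j⟩ :=
  Fin.lastCases_castSucc (motive := fun _ => G.Vert ⊕ (Σ e : G.Edge, Fin (k e))) j

theorem split_lo_inl_of_mem (S : Set G.Vert) {e : G.Edge} (h : G.lo e ∈ S) :
    (G.split S).lo (Sum.inl e) = Sum.inr ⟨G.lo e, h⟩ := dif_pos h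

theorem split_lo_inl_of_notMem (S : Set G.Vert) {e : G.Edge} (h : G.lo e ∉ S) :
    (G.split S).lo (Sum.inl e) = Sum.inl (G.lo e) := dif_neg h

end Multigraph

/-! ### Linear covers of the image -/

/-- A cover of `Z ⊆ ℝ` by relatively open intervals, listed from left to right, in which only
consecutive members meet. -/
structure IsLinearCover (Z : Set ℝ) (U : ℕ → Set ℝ) : Prop where
  covers : ⋃ n, U n = Z
  ordConnected : ∀ n, (U n).OrdConnected
  exists_isOpen : ∀ n, ∃ I : Set ℝ, IsOpen I ∧ U n = I ∩ Z
  disjoint : ∀ m n, m + 1 < n → Disjoint (U m) (U n)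
  mem_of_le : ∀ m n, m < n → ∀ x ∈ U n, ∀ y ∈ U m, x ≤ y → x ∈ U m ∧ y ∈ U n

/-- The index of the first member of `U` that contains `a`. -/
noncomputable def lowIndex (U : ℕ → Set ℝ) (a : ℝ) : ℕ := sInf {n | a ∈ U n}

/-- The index of the last member of `U` that contains `a`. -/
noncomputable def highIndex (U : ℕ → Set ℝ) (a : ℝ) : ℕ := sSup {n | a ∈ U n}

namespace IsLinearCover

variable {Z : Set ℝ} {U : ℕ → Set ℝ}

/-- By connectedness of `Icc x y`, some point lies both in a member numbered at most `i` and in one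
numbered above `i`. Only consecutive members meet, so these are `U i` and `U (i + 1)`. -/
theorem exists_mem_overlap (hc : IsLinearCover Z U) {x y : ℝ} (hxy : x ≤ y) (hZ : Icc x y ⊆ Z)
    {n m i : ℕ} (hx : x ∈ U n) (hy : y ∈ U m) (hni : n ≤ i) (him : i < m) :
    ∃ z ∈ Icc x y, z ∈ U i ∩ U (i + 1) := by
  choose I hI hUI using hc.exists_isOpen
  have hsub : ∀ n, U n ⊆ I n := fun n => by rw [hUI n]; exact inter_subset_left
  obtain ⟨z, hz, hz₁, hz₂⟩ := isPreconnected_Icc (a := x) (b := y) (⋃ j ∈ Iic i, I j)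
    (⋃ j ∈ Ioi i, I j) (isOpen_biUnion fun j _ => hI j) (isOpen_biUnion fun j _ => hI j) (by
      intro w hw
      obtain ⟨j, hj⟩ := mem_iUnion.1 (hc.covers.symm ▸ hZ hw : w ∈ ⋃ n, U n)
      obtain hji | hji := le_or_gt j i
      · exact Or.inl (mem_biUnion hji (hsub j hj))
      · exact Or.inr (mem_biUnion hji (hsub j hj)))
    ⟨x, ⟨le_rfl, hxy⟩, mem_biUnion hni (hsub n hx)⟩
    ⟨y, ⟨hxy, le_rfl⟩, mem_biUnion him (hsub m hy)⟩
  obtain ⟨j, hj, hzj⟩ := mem_iUnion₂.1 hz₁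
  obtain ⟨j', hj', hzj'⟩ := mem_iUnion₂.1 hz₂
  have h₁ : z ∈ U j := by rw [hUI]; exact ⟨hzj, hZ hz⟩
  have h₂ : z ∈ U j' := by rw [hUI]; exact ⟨hzj', hZ hz⟩
  simp only [mem_Iic, mem_Ioi] at hj hj'
  have h₃ : j' ≤ j + 1 := by
    by_contra! hlt
    exact disjoint_left.1 (hc.disjoint _ _ hlt) h₁ h₂
  obtain rfl : j = i := by omega
  obtain rfl : j' = j + 1 := by omega
  exact ⟨z, hz, h₁, h₂⟩

theorem le_succ_of_mem (hc : IsLinearCover Z U) {a : ℝ} {m n : ℕ} (hm : a ∈ U m) (hn : a ∈ U n) :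
    n ≤ m + 1 := by
  by_contra! hlt
  exact disjoint_left.1 (hc.disjoint _ _ hlt) hm hn

theorem nonempty_index (hc : IsLinearCover Z U) {a : ℝ} (ha : a ∈ Z) : {n | a ∈ U n}.Nonempty := by
  rw [← hc.covers] at ha
  exact mem_iUnion.1 ha

theorem bddAbove_index (hc : IsLinearCover Z U) {a : ℝ} (ha : a ∈ Z) :
    BddAbove {n | a ∈ U n} := by
  obtain ⟨m, hm⟩ := hc.nonempty_index ha
  exact ⟨m + 1, fun n hn => hc.le_succ_of_mem hm hn⟩

theorem mem_lowIndex (hc : IsLinearCover Z U) {a : ℝ} (ha : a ∈ Z) : a ∈ U (lowIndex U a) :=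
  Nat.sInf_mem (hc.nonempty_index ha)

theorem mem_highIndex (hc : IsLinearCover Z U) {a : ℝ} (ha : a ∈ Z) : a ∈ U (highIndex U a) :=
  Nat.sSup_mem (hc.nonempty_index ha) (hc.bddAbove_index ha)

theorem lowIndex_le {a : ℝ} {n : ℕ} (hn : a ∈ U n) : lowIndex U a ≤ n := Nat.sInf_le hn

theorem le_highIndex (hc : IsLinearCover Z U) {a : ℝ} (ha : a ∈ Z) {n : ℕ} (hn : a ∈ U n) :
    n ≤ highIndex U a :=
  le_csSup (hc.bddAbove_index ha) hn

theorem highIndex_le (hc : IsLinearCover Z U) {a : ℝ} (ha : a ∈ Z) :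
    highIndex U a ≤ lowIndex U a + 1 :=
  hc.le_succ_of_mem (hc.mem_lowIndex ha) (hc.mem_highIndex ha)

theorem lowIndex_le_highIndex (hc : IsLinearCover Z U) {a : ℝ} (ha : a ∈ Z) :
    lowIndex U a ≤ highIndex U a :=
  lowIndex_le (hc.mem_highIndex ha)

end IsLinearCover

/-! ### Position of Reeb nodes and edges relative to a linear cover -/

section

variable {X : Type u} [TopologicalSpace X] {f : X → ℝ} {A : Set ℝ} {U : ℕ → Set ℝ}

theorem mem_overlapNodes_iff (hc : IsLinearCover (range f) U) (p : ReebNode f A) :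
    p ∈ overlapNodes f A U ↔ highIndex U p.height = lowIndex U p.height + 1 := by
  have hp := p.height_mem_range
  have h₁ := hc.highIndex_le hp
  constructor
  · rintro ⟨m, n, hmn, hm, hn⟩
    have := IsLinearCover.lowIndex_le hm
    have := IsLinearCover.lowIndex_le hn
    have := hc.le_highIndex hp hm
    have := hc.le_highIndex hp hn
    omega
  · intro h
    exact ⟨lowIndex U p.height, highIndex U p.height, by omega, hc.mem_lowIndex hp,
      hc.mem_highIndex hp⟩

theorem notMem_overlapNodes_iff (hc : IsLinearCover (range f) U) (p : ReebNode f A) :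
    p ∉ overlapNodes f A U ↔ highIndex U p.height = lowIndex U p.height := by
  rw [mem_overlapNodes_iff hc]
  have := hc.highIndex_le p.height_mem_range
  have := hc.lowIndex_le_highIndex p.height_mem_range
  omega

namespace ReebNode

theorem eq_of_joinedIn_rep (h : IsTelescopic f A) {J : Set ℝ} (hJ : J.OrdConnected)
    (hJA : (J ∩ A).Subsingleton) {p q : ReebNode f A} (hpq : JoinedIn (f ⁻¹' J) p.rep q.rep) :
    p = q := by
  have hp : p.height ∈ J := p.map_rep ▸ hpq.source_mem
  have hq : q.height ∈ J := q.map_rep ▸ hpq.target_mem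
  have hh : p.height = q.height := hJA ⟨hp, p.height_mem⟩ ⟨hq, q.height_mem⟩
  exact eq_of_joinedIn p.rep_mem_carrier q.rep_mem_carrier (h.joinedIn_fibre J hJ _ hp
    (fun z hz => hJA hz ⟨hp, p.height_mem⟩) _ _ p.map_rep (q.map_rep.trans hh.symm) hpq)

theorem exists_joinedIn_rep (h : IsTelescopic f A) {J : Set ℝ} (hJ : J.OrdConnected)
    (hJA : (J ∩ A).Subsingleton) {a : ℝ} (ha : a ∈ J ∩ A) {x : X} (hx : f x ∈ J) :
    ∃ p : ReebNode f A, p.height = a ∧ JoinedIn (f ⁻¹' J) p.rep x := by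
  obtain ⟨y, rfl, hxy⟩ := h.exists_joinedIn J hJ a ha.1 (fun z hz => hJA hz ha) x hx
  refine ⟨ofPoint y ha.2, rfl, ?_⟩
  exact ((joinedIn_of_mem_carrier (rep_mem_carrier _) (mem_carrier_ofPoint y ha.2)).mono
    (preimage_mono (singleton_subset_iff.2 ha.1))).trans hxy.symm

end ReebNode

namespace ReebEdge

/-- The connection inside the component is shrunk to `J ∩ Ioo`, which is allowed because the open
gap has no critical value. -/
theorem joinedIn_of_mem_comp (h : IsTelescopic f A) (e : ReebEdge f A) {J : Set ℝ}
    (hJ : J.OrdConnected) {x y : X} (hx : x ∈ e.comp) (hy : y ∈ e.comp) (hxJ : f x ∈ J)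
    (hyJ : f y ∈ J) : JoinedIn (f ⁻¹' J) x y := by
  have hx' := e.map_mem_Ioo hx
  have hy' := e.map_mem_Ioo hy
  exact (h.joinedIn_of_subset (hJ.inter ordConnected_Ioo) ordConnected_Ioo inter_subset_right
    ⟨hxJ, hx'⟩ (by rw [e.consecutive.symm.inter_eq]; exact empty_subset _) ⟨hxJ, hx'⟩ ⟨hyJ, hy'⟩
    (e.isCC.joinedIn hx hy)).mono (preimage_mono inter_subset_left)

theorem joinedIn_lo_rep (h : IsTelescopic f A) (e : ReebEdge f A) {J : Set ℝ}
    (hJ : J.OrdConnected) (hlo : e.lo.height ∈ J) {x : X} (hx : x ∈ e.comp) (hxJ : f x ∈ J) :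
    JoinedIn (f ⁻¹' J) e.lo.rep x := by
  have hlo' : e.lo.height ∈ J ∩ Ico e.lo.height e.hi.height := ⟨hlo, le_rfl, e.lt⟩
  exact (h.joinedIn_of_subset (hJ.inter ordConnected_Ico) ordConnected_Ico inter_subset_right
    hlo' e.Ico_inter_subset (e.lo.map_rep.symm ▸ hlo') ⟨hxJ, Ioo_subset_Ico_self (e.map_mem_Ioo hx)⟩
    (e.joinedIn_Ico e.lo.rep_mem_carrier hx)).mono (preimage_mono inter_subset_left)

theorem joinedIn_hi_rep (h : IsTelescopic f A) (e : ReebEdge f A) {J : Set ℝ}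
    (hJ : J.OrdConnected) (hhi : e.hi.height ∈ J) {x : X} (hx : x ∈ e.comp) (hxJ : f x ∈ J) :
    JoinedIn (f ⁻¹' J) e.hi.rep x := by
  have hhi' : e.hi.height ∈ J ∩ Ioc e.lo.height e.hi.height := ⟨hhi, e.lt, le_rfl⟩
  exact (h.joinedIn_of_subset (hJ.inter ordConnected_Ioc) ordConnected_Ioc inter_subset_right
    hhi' e.Ioc_inter_subset (e.hi.map_rep.symm ▸ hhi') ⟨hxJ, Ioo_subset_Ioc_self (e.map_mem_Ioo hx)⟩
    (e.joinedIn_Ioc e.hi.rep_mem_carrier hx)).mono (preimage_mono inter_subset_left)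

/-- Otherwise the order of the members would put both end heights, two distinct critical values,
into one member. -/
theorem highIndex_lt_lowIndex (hc : IsLinearCover (range f) U)
    (hA : ∀ n, (U n ∩ A).Subsingleton) (e : ReebEdge f A) :
    highIndex U e.lo.height < lowIndex U e.hi.height := by
  have hlo := hc.mem_highIndex e.lo.height_mem_range
  have hhi := hc.mem_lowIndex e.hi.height_mem_range
  by_contra! hle
  have hmem : e.hi.height ∈ U (highIndex U e.lo.height) := by
    obtain heq | hlt := hle.eq_or_lt
    · rwa [← heq]
    · exact (hc.mem_of_le _ _ hlt _ hlo _ hhi e.lt.le).2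
  exact e.lt.ne (hA _ ⟨hlo, e.lo.height_mem⟩ ⟨hmem, e.hi.height_mem⟩)

theorem exists_mem_overlap (h : IsTelescopic f A) (hc : IsLinearCover (range f) U)
    (e : ReebEdge f A) {i : ℕ} (hi : highIndex U e.lo.height ≤ i)
    (hi' : i < lowIndex U e.hi.height) :
    ∃ z ∈ Ioo e.lo.height e.hi.height, z ∈ U i ∩ U (i + 1) := by
  obtain ⟨z, hz, hzi⟩ := hc.exists_mem_overlap e.lt.le (e.Icc_subset_range h)
    (hc.mem_highIndex e.lo.height_mem_range) (hc.mem_lowIndex e.hi.height_mem_range) hi hi'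
  -- The point is not an end: the lower height lies in no member after its last one, hence not in `U
  -- (i + 1)`, and the upper height lies in none before its first one.
  refine ⟨z, ⟨lt_of_le_of_ne hz.1 ?_, lt_of_le_of_ne hz.2 ?_⟩, hzi⟩
  · rintro rfl
    have := hc.le_highIndex e.lo.height_mem_range hzi.2
    omega
  · rintro rfl
    have := IsLinearCover.lowIndex_le hzi.1
    omega

theorem disjoint_of_mem_Ioo (e : ReebEdge f A) {J : Set ℝ} (hJ : J.OrdConnected)
    (hlo : e.lo.height ∉ J) (hhi : e.hi.height ∉ J) {z : ℝ} (hz : z ∈ J)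
    (hze : z ∈ Ioo e.lo.height e.hi.height) : Disjoint J A := by
  rw [disjoint_left]
  intro a ha haA
  have hne := disjoint_left.1 e.consecutive haA
  rw [mem_Ioo, not_and_or, not_lt, not_lt] at hne
  obtain hle | hle := hne
  · exact hlo (hJ.out ha hz ⟨hle, hze.1.le⟩)
  · exact hhi (hJ.out hz ha ⟨hze.2.le, hle⟩)

theorem disjoint_overlap (h : IsTelescopic f A) (hc : IsLinearCover (range f) U)
    (e : ReebEdge f A) {i : ℕ} (hi : highIndex U e.lo.height ≤ i)
    (hi' : i < lowIndex U e.hi.height) : Disjoint (U i ∩ U (i + 1)) A := by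
  obtain ⟨z, hze, hzi⟩ := e.exists_mem_overlap h hc hi hi'
  refine e.disjoint_of_mem_Ioo ((hc.ordConnected _).inter (hc.ordConnected _)) ?_ ?_ hzi hze
  · intro hlo
    have := hc.le_highIndex e.lo.height_mem_range hlo.2
    omega
  · intro hhi
    have := IsLinearCover.lowIndex_le hhi.1
    omega

theorem exists_mem_of_lt (h : IsTelescopic f A) (hc : IsLinearCover (range f) U)
    (e : ReebEdge f A) {n : ℕ} (hn : highIndex U e.lo.height < n)
    (hn' : n < lowIndex U e.hi.height) :
    ∃ z ∈ Ioo e.lo.height e.hi.height, z ∈ U n := by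
  obtain ⟨z, hze, hz⟩ := e.exists_mem_overlap h hc hn.le hn'
  exact ⟨z, hze, hz.1⟩

theorem disjoint_of_lt (h : IsTelescopic f A) (hc : IsLinearCover (range f) U)
    (e : ReebEdge f A) {n : ℕ} (hn : highIndex U e.lo.height < n)
    (hn' : n < lowIndex U e.hi.height) : Disjoint (U n) A := by
  obtain ⟨z, hze, hz⟩ := e.exists_mem_of_lt h hc hn hn'
  refine e.disjoint_of_mem_Ioo (hc.ordConnected _) ?_ ?_ hz hze
  · intro hlo
    have := hc.le_highIndex e.lo.height_mem_range hlo
    omega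
  · intro hhi
    have := IsLinearCover.lowIndex_le hhi
    omega

theorem highIndex_lt_of_disjoint (hc : IsLinearCover (range f) U) (e : ReebEdge f A) {n : ℕ}
    (hn : Disjoint (U n) A) {z : ℝ} (hz : z ∈ U n) (hze : z ∈ Ioo e.lo.height e.hi.height) :
    highIndex U e.lo.height < n := by
  have hlo := hc.mem_highIndex e.lo.height_mem_range
  by_contra! hle
  refine disjoint_left.1 hn ?_ e.lo.height_mem
  obtain heq | hlt := hle.eq_or_lt
  · rwa [heq]
  · exact (hc.mem_of_le _ _ hlt _ hlo _ hz hze.1.le).1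

theorem lt_lowIndex_of_disjoint (hc : IsLinearCover (range f) U) (e : ReebEdge f A) {n : ℕ}
    (hn : Disjoint (U n) A) {z : ℝ} (hz : z ∈ U n) (hze : z ∈ Ioo e.lo.height e.hi.height) :
    n < lowIndex U e.hi.height := by
  have hhi := hc.mem_lowIndex e.hi.height_mem_range
  by_contra! hle
  refine disjoint_left.1 hn ?_ e.hi.height_mem
  obtain heq | hlt := hle.eq_or_lt
  · rwa [← heq]
  · exact (hc.mem_of_le _ _ hlt _ hz _ hhi hze.2.le).2

theorem highIndex_le_of_disjoint (hc : IsLinearCover (range f) U) (e : ReebEdge f A) {i : ℕ}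
    (hi : Disjoint (U i ∩ U (i + 1)) A) {z : ℝ} (hz : z ∈ U i ∩ U (i + 1))
    (hze : z ∈ Ioo e.lo.height e.hi.height) : highIndex U e.lo.height ≤ i := by
  have hlo := hc.mem_highIndex e.lo.height_mem_range
  by_contra! hlt
  have hmem := hc.mem_of_le _ _ hlt _ hlo _ hz.1 hze.1.le
  have hle := hc.le_succ_of_mem hmem.1 hlo
  have heq : highIndex U e.lo.height = i + 1 := by omega
  exact disjoint_left.1 hi ⟨hmem.1, heq ▸ hlo⟩ e.lo.height_mem

theorem lt_lowIndex_of_disjoint_overlap (hc : IsLinearCover (range f) U) (e : ReebEdge f A)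
    {i : ℕ} (hi : Disjoint (U i ∩ U (i + 1)) A) {z : ℝ} (hz : z ∈ U i ∩ U (i + 1))
    (hze : z ∈ Ioo e.lo.height e.hi.height) : i < lowIndex U e.hi.height := by
  have hhi := hc.mem_lowIndex e.hi.height_mem_range
  by_contra! hle
  have hmem := hc.mem_of_le _ _ (Nat.lt_succ_of_le hle) _ hz.2 _ hhi hze.2.le
  have hle' := hc.le_succ_of_mem hhi hmem.2
  have heq : lowIndex U e.hi.height = i := by omega
  exact disjoint_left.1 hi ⟨heq ▸ hhi, hmem.2⟩ e.hi.height_mem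

/-- The members counted are exactly those numbered strictly between the last one containing the
lower end and the first one containing the upper end. -/
theorem highIndex_add_crossingCount (h : IsTelescopic f A) (hc : IsLinearCover (range f) U)
    (hA : ∀ n, (U n ∩ A).Subsingleton) (e : ReebEdge f A) :
    highIndex U e.lo.height + crossingCount U e + 1 = lowIndex U e.hi.height := by
  have hlt := e.highIndex_lt_lowIndex hc hA
  have hset : {n : ℕ | Disjoint (U n) A ∧ (U n ∩ Ioo e.lo.height e.hi.height).Nonempty} =
      ((Finset.Ioo (highIndex U e.lo.height) (lowIndex U e.hi.height) : Finset ℕ) : Set ℕ) := by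
    ext n
    simp only [mem_ofPred_eq, Finset.coe_Ioo, mem_Ioo]
    constructor
    · rintro ⟨hn, z, hz, hze⟩
      exact ⟨e.highIndex_lt_of_disjoint hc hn hz hze, e.lt_lowIndex_of_disjoint hc hn hz hze⟩
    · rintro ⟨hn, hn'⟩
      obtain ⟨z, hze, hz⟩ := e.exists_mem_of_lt h hc hn hn'
      exact ⟨e.disjoint_of_lt h hc hn hn', z, hz, hze⟩
  rw [crossingCount, hset, ncard_coe_finset, Nat.card_Ioo]
  omega

end ReebEdge

end

/-! ### The modified Reeb graph as a model of the multinerve -/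

section

variable {X : Type u} [TopologicalSpace X] {f : X → ℝ} {A : Set ℝ} {U : ℕ → Set ℝ}

/-- The subdivided and split combinatorial Reeb graph models the multinerve of the preimages of a
linear cover. -/
theorem nonempty_multinerveModel (h : IsTelescopic f A) (hc : IsLinearCover (range f) U)
    (hA : ∀ n, (U n ∩ A).Subsingleton) :
    Nonempty (MultinerveModel (((combReebGraph f A).subdivide (crossingCount U)).split
      (Sum.inl '' overlapNodes f A U)) (fun n => f ⁻¹' U n)) := by
  have hk : ∀ e : ReebEdge f A, _ := fun e => e.highIndex_add_crossingCount h hc hA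
  have hoc : ∀ i, (U i ∩ U (i + 1)).OrdConnected := fun i =>
    (hc.ordConnected i).inter (hc.ordConnected (i + 1))
  have hA' : ∀ i, (U i ∩ U (i + 1) ∩ A).Subsingleton := fun i =>
    (hA i).anti (inter_subset_inter_left A inter_subset_left)
  have hpt : ∀ (e : ReebEdge f A) (j : Fin (crossingCount U e)),
      ∃ x ∈ e.comp, f x ∈ U (highIndex U e.lo.height + 1 + j) := fun e j => by
    obtain ⟨z, hze, hz⟩ := e.exists_mem_of_lt h hc (n := highIndex U e.lo.height + 1 + j)
      (by omega) (by have := hk e; omega)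
    obtain ⟨x, hx, rfl⟩ := e.exists_mem_comp h hze
    exact ⟨x, hx, hz⟩
  have hpt' : ∀ (e : ReebEdge f A) (j : Fin (crossingCount U e + 1)),
      ∃ x ∈ e.comp, f x ∈ U (highIndex U e.lo.height + j) ∩ U (highIndex U e.lo.height + j + 1) :=
    fun e j => by
      obtain ⟨z, hze, hz⟩ := e.exists_mem_overlap h hc (i := highIndex U e.lo.height + j)
        (by omega) (by have := hk e; omega)
      obtain ⟨x, hx, rfl⟩ := e.exists_mem_comp h hze
      exact ⟨x, hx, hz⟩
  -- `q e j` represents the inserted vertex `j` of `e`, and `r e j` the edge `j` of the path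
  -- replacing `e`; both lie in the component of `e`.
  choose q hqe hqU using hpt
  choose r hre hrU using hpt'
  have hqA : ∀ (e : ReebEdge f A) (j : Fin (crossingCount U e)),
      Disjoint (U (highIndex U e.lo.height + 1 + j)) A := fun e j =>
    e.disjoint_of_lt h hc (by omega) (by have := hk e; omega)
  have hrA : ∀ (e : ReebEdge f A) (j : Fin (crossingCount U e + 1)),
      Disjoint (U (highIndex U e.lo.height + j) ∩ U (highIndex U e.lo.height + j + 1)) A :=
    fun e j => e.disjoint_overlap h hc (by omega) (by have := hk e; omega)
  have hlow : ∀ p : ReebNode f A, p.height ∈ U (lowIndex U p.height) := fun p =>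
    hc.mem_lowIndex p.height_mem_range
  have hhigh : ∀ p : ReebNode f A, p.height ∈ U (highIndex U p.height) := fun p =>
    hc.mem_highIndex p.height_mem_range
  have hboth : ∀ p ∈ overlapNodes f A U,
      p.height ∈ U (lowIndex U p.height) ∩ U (lowIndex U p.height + 1) := fun p hp =>
    ⟨hlow p, (mem_overlapNodes_iff hc p).1 hp ▸ hhigh p⟩
  -- Unsplit nodes and lower copies are placed in the first member containing their height. Inserted
  -- vertices occupy the members following the last one that contains the lower end.
  let Vi : (ReebNode f A ⊕ Σ e : ReebEdge f A, Fin (crossingCount U e)) → ℕ :=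
    Sum.elim (fun p => lowIndex U p.height) (fun w => highIndex U w.1.lo.height + 1 + w.2)
  let Vx : (ReebNode f A ⊕ Σ e : ReebEdge f A, Fin (crossingCount U e)) → X :=
    Sum.elim (fun p => p.rep) (fun w => q w.1 w.2)
  -- Upper copies are placed in the last member. The value `0` is never used, since `S` contains no
  -- inserted vertices.
  let Ti : (ReebNode f A ⊕ Σ e : ReebEdge f A, Fin (crossingCount U e)) → ℕ :=
    Sum.elim (fun p => highIndex U p.height) (fun _ => 0)
  let S : Set (ReebNode f A ⊕ Σ e : ReebEdge f A, Fin (crossingCount U e)) :=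
    Sum.inl '' overlapNodes f A U
  let vi : (ReebNode f A ⊕ Σ e : ReebEdge f A, Fin (crossingCount U e)) ⊕ S → ℕ :=
    Sum.elim Vi (fun w => Ti w.1)
  let vx : (ReebNode f A ⊕ Σ e : ReebEdge f A, Fin (crossingCount U e)) ⊕ S → X :=
    Sum.elim Vx (fun w => Vx w.1)
  let ei : (Σ e : ReebEdge f A, Fin (crossingCount U e + 1)) ⊕ S → ℕ :=
    Sum.elim (fun w => highIndex U w.1.lo.height + w.2) (fun w => Vi w.1)
  let ex : (Σ e : ReebEdge f A, Fin (crossingCount U e + 1)) ⊕ S → X :=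
    Sum.elim (fun w => r w.1 w.2) (fun w => Vx w.1)
  let G := (combReebGraph f A).subdivide (crossingCount U)
  let lo : (Σ e : ReebEdge f A, Fin (crossingCount U e + 1)) ⊕ S →
    (ReebNode f A ⊕ Σ e : ReebEdge f A, Fin (crossingCount U e)) ⊕ S := (G.split S).lo
  let hi : (Σ e : ReebEdge f A, Fin (crossingCount U e + 1)) ⊕ S →
    (ReebNode f A ⊕ Σ e : ReebEdge f A, Fin (crossingCount U e)) ⊕ S := (G.split S).hi
  have hlo : ∀ e : (Σ e : ReebEdge f A, Fin (crossingCount U e + 1)) ⊕ S,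
      vi (lo e) = ei e ∧ JoinedIn (f ⁻¹' U (ei e)) (vx (lo e)) (ex e) := by
    rintro (⟨e, j⟩ | ⟨_, p, hp, rfl⟩)
    · have hjoin : f (r e j) ∈ U (highIndex U e.lo.height + j) := (hrU e j).1
      obtain rfl | ⟨j, rfl⟩ := j.eq_zero_or_eq_succ
      · have hjl := e.joinedIn_lo_rep h (hc.ordConnected _) (hhigh e.lo) (hre e 0) hjoin
        -- The first edge of the path leaves the upper copy if the node is split; otherwise first
        -- and last index agree and the original node serves.
        by_cases hS : e.lo ∈ overlapNodes f A U
        · have hG : lo (Sum.inl ⟨e, 0⟩) = Sum.inr ⟨Sum.inl e.lo, e.lo, hS, rfl⟩ :=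
            Multigraph.split_lo_inl_of_mem G S (e := ⟨e, 0⟩) ⟨e.lo, hS, rfl⟩
          rw [hG]
          exact ⟨rfl, hjl⟩
        · have hG : lo (Sum.inl ⟨e, 0⟩) = Sum.inl (Sum.inl e.lo) :=
            Multigraph.split_lo_inl_of_notMem G S (e := ⟨e, 0⟩) (by
              rintro ⟨p, hp, hpe⟩
              exact hS ((Sum.inl_injective hpe : p = e.lo) ▸ hp))
          rw [hG]
          exact ⟨((notMem_overlapNodes_iff hc _).1 hS).symm, hjl⟩
      · have hG : lo (Sum.inl ⟨e, j.succ⟩) = Sum.inl (Sum.inr ⟨e, j⟩) :=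
          Multigraph.split_lo_inl_of_notMem G S (e := ⟨e, j.succ⟩) (by
            rintro ⟨p, hp, hpe⟩
            exact Sum.inl_ne_inr hpe)
        rw [hG]
        have hi : highIndex U e.lo.height + 1 + (j : ℕ) =
            highIndex U e.lo.height + (j.succ : Fin _) := by rw [Fin.val_succ]; omega
        exact ⟨hi, e.joinedIn_of_mem_comp h (hc.ordConnected _) (hqe e j) (hre e j.succ)
          (by have := hqU e j; rw [hi] at this; exact this) hjoin⟩
    · exact ⟨rfl, JoinedIn.refl (show f p.rep ∈ _ by rw [p.map_rep]; exact hlow p)⟩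
  have hhi : ∀ e : (Σ e : ReebEdge f A, Fin (crossingCount U e + 1)) ⊕ S,
      vi (hi e) = ei e + 1 ∧ JoinedIn (f ⁻¹' U (ei e + 1)) (vx (hi e)) (ex e) := by
    rintro (⟨e, j⟩ | ⟨_, p, hp, rfl⟩)
    · have hjoin : f (r e j) ∈ U (highIndex U e.lo.height + j + 1) := (hrU e j).2
      obtain ⟨j, rfl⟩ | rfl := j.eq_castSucc_or_eq_last
      · have hG : hi (Sum.inl ⟨e, j.castSucc⟩) = Sum.inl (Sum.inr ⟨e, j⟩) :=
          congrArg Sum.inl (Multigraph.subdivide_hi_castSucc (combReebGraph f A) _ e j)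
        rw [hG]
        have hi : highIndex U e.lo.height + 1 + (j : ℕ) =
            highIndex U e.lo.height + (j.castSucc : Fin _) + 1 := by
          rw [Fin.val_castSucc]; omega
        exact ⟨hi, e.joinedIn_of_mem_comp h (hc.ordConnected _) (hqe e j) (hre e j.castSucc)
          (hi ▸ hqU e j) hjoin⟩
      · have hG : hi (Sum.inl ⟨e, Fin.last _⟩) = Sum.inl (Sum.inl e.hi) :=
          congrArg Sum.inl (Multigraph.subdivide_hi_last (combReebGraph f A) _ e)
        rw [hG]
        have hi : lowIndex U e.hi.height =
            highIndex U e.lo.height + (Fin.last (crossingCount U e) : ℕ) + 1 := (hk e).symm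
        exact ⟨hi, e.joinedIn_hi_rep h (hc.ordConnected _) (hi ▸ hlow e.hi) (hre e _) hjoin⟩
    · exact ⟨(mem_overlapNodes_iff hc p).1 hp,
        JoinedIn.refl (show f p.rep ∈ _ by rw [p.map_rep]; exact (hboth p hp).2)⟩
  exact ⟨{
    vi := vi
    vx := vx
    ei := ei
    ex := ex
    disjoint := fun i j hij => (hc.disjoint i j hij).preimage f
    vx_mem := by
      rintro ((p | ⟨e, j⟩) | ⟨_, p, hp, rfl⟩)
      · exact (p.map_rep.symm ▸ hlow p : f p.rep ∈ U (lowIndex U p.height))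
      · exact hqU e j
      · exact (p.map_rep.symm ▸ hhigh p : f p.rep ∈ U (highIndex U p.height))
    ex_mem := by
      rintro (⟨e, j⟩ | ⟨_, p, hp, rfl⟩)
      · exact hrU e j
      · show f p.rep ∈ U (lowIndex U p.height) ∩ U (lowIndex U p.height + 1)
        rw [p.map_rep]
        exact hboth p hp
    vert_inj := by
      have hne : ∀ p ∈ overlapNodes f A U, highIndex U p.height ≠ lowIndex U p.height :=
        fun p hp => by have := (mem_overlapNodes_iff hc p).1 hp; omega
      have hpp : ∀ {p p' : ReebNode f A} {i j}, i = j → JoinedIn (f ⁻¹' U i) p.rep p'.rep → p = p' :=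
        fun _ hj => ReebNode.eq_of_joinedIn_rep h (hc.ordConnected _) (hA _) hj
      -- A node and an inserted vertex never share a member, because the member of an inserted
      -- vertex avoids the critical values.
      have hpe : ∀ {p : ReebNode f A} {e : ReebEdge f A} {j : Fin (crossingCount U e)}
          {i : ℕ}, p.height ∈ U i → i ≠ highIndex U e.lo.height + 1 + j := by
        rintro p e j _ hmem rfl
        exact disjoint_left.1 (hqA e j) hmem p.height_mem
      rintro ((p | ⟨e, j⟩) | ⟨_, p, hp, rfl⟩) ((p' | ⟨e', j'⟩) | ⟨_, p', hp', rfl⟩) hi hj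
      · rw [hpp hi hj]
      · exact (hpe (hlow p) hi).elim
      · obtain rfl := hpp hi hj
        exact (hne p hp' hi.symm).elim
      · exact (hpe (hlow p') hi.symm).elim
      · obtain rfl := e.eq_of_joinedIn h (hc.ordConnected _) (hqA e j) (hqe e j) (hqe e' j') hj
        have hi' : highIndex U e.lo.height + 1 + (j : ℕ) =
          highIndex U e.lo.height + 1 + (j' : ℕ) := hi
        obtain rfl : j = j' := Fin.ext (by omega)
        rfl
      · exact (hpe (hhigh p') hi.symm).elim
      · obtain rfl := hpp hi hj
        exact (hne p hp hi).elim
      · exact (hpe (hhigh p) hi).elim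
      · obtain rfl := hpp hi hj
        rfl
    vert_surj := by
      intro i x hx
      -- Without a critical value, `x` lies on a Reeb edge and gives an inserted vertex. With one,
      -- `x` slides to a node, and `i` is the first or the last member containing its height.
      by_cases hd : Disjoint (U i) A
      · obtain ⟨e, he⟩ := ReebEdge.exists_mem h x (disjoint_left.1 hd hx)
        have h₁ := e.highIndex_lt_of_disjoint hc hd hx (e.map_mem_Ioo he)
        have h₂ := e.lt_lowIndex_of_disjoint hc hd hx (e.map_mem_Ioo he)
        have h₃ := hk e
        obtain ⟨j, rfl⟩ : ∃ j : Fin (crossingCount U e), highIndex U e.lo.height + 1 + j = i :=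
          ⟨⟨i - (highIndex U e.lo.height + 1), by omega⟩, by simp only; omega⟩
        exact ⟨Sum.inl (Sum.inr ⟨e, j⟩), rfl,
          e.joinedIn_of_mem_comp h (hc.ordConnected _) (hqe e j) he (hqU e j) hx⟩
      · obtain ⟨a, ha⟩ := not_disjoint_iff.1 hd
        obtain ⟨p, rfl, hp⟩ := ReebNode.exists_joinedIn_rep h (hc.ordConnected i) (hA i) ha hx
        have h₁ := IsLinearCover.lowIndex_le ha.1
        have h₂ := hc.le_highIndex p.height_mem_range ha.1
        have h₃ := hc.highIndex_le p.height_mem_range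
        obtain hi | hi : lowIndex U p.height = i ∨ highIndex U p.height = i := by omega
        · exact ⟨Sum.inl (Sum.inl p), hi, hp⟩
        · by_cases hS : p ∈ overlapNodes f A U
          · exact ⟨Sum.inr ⟨Sum.inl p, p, hS, rfl⟩, hi, hp⟩
          · exact ⟨Sum.inl (Sum.inl p), ((notMem_overlapNodes_iff hc p).1 hS).symm.trans hi, hp⟩
    edge_inj := by
      rintro (⟨e, j⟩ | ⟨_, p, hp, rfl⟩) (⟨e', j'⟩ | ⟨_, p', hp', rfl⟩) hi hj
      · obtain rfl := e.eq_of_joinedIn h (hoc _) (hrA e j) (hre e j) (hre e' j') hj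
        have hi' : highIndex U e.lo.height + (j : ℕ) = highIndex U e.lo.height + (j' : ℕ) := hi
        obtain rfl : j = j' := Fin.ext (by omega)
        rfl
      · have hi' : highIndex U e.lo.height + (j : ℕ) = lowIndex U p'.height := hi
        exact (disjoint_left.1 (hrA e j) (by rw [hi']; exact hboth p' hp') p'.height_mem).elim
      · have hi' : lowIndex U p.height = highIndex U e'.lo.height + (j' : ℕ) := hi
        exact (disjoint_left.1 (hrA e' j') (by rw [← hi']; exact hboth p hp) p.height_mem).elim
      · obtain rfl := ReebNode.eq_of_joinedIn_rep h (hoc _) (hA' _) hj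
        rfl
    edge_surj := by
      intro i x hx
      -- An overlap without a critical value gives an edge of a subdivided path; one with a critical
      -- value gives the new edge of a split node.
      by_cases hd : Disjoint (U i ∩ U (i + 1)) A
      · obtain ⟨e, he⟩ := ReebEdge.exists_mem h x (disjoint_left.1 hd hx)
        have h₁ := e.highIndex_le_of_disjoint hc hd hx (e.map_mem_Ioo he)
        have h₂ := e.lt_lowIndex_of_disjoint_overlap hc hd hx (e.map_mem_Ioo he)
        have h₃ := hk e
        obtain ⟨j, rfl⟩ : ∃ j : Fin (crossingCount U e + 1), highIndex U e.lo.height + j = i :=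
          ⟨⟨i - highIndex U e.lo.height, by omega⟩, by simp only; omega⟩
        exact ⟨Sum.inl ⟨e, j⟩, rfl,
          e.joinedIn_of_mem_comp h (hoc _) (hre e j) he (hrU e j) hx⟩
      · obtain ⟨a, ha⟩ := not_disjoint_iff.1 hd
        obtain ⟨p, rfl, hp⟩ := ReebNode.exists_joinedIn_rep h (hoc i) (hA' i) ha hx
        have h₁ := IsLinearCover.lowIndex_le ha.1.1
        have h₂ := hc.le_highIndex p.height_mem_range ha.1.2
        have h₃ := hc.highIndex_le p.height_mem_range
        have hS : p ∈ overlapNodes f A U := (mem_overlapNodes_iff hc p).2 (by omega)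
        exact ⟨Sum.inr ⟨Sum.inl p, p, hS, rfl⟩, (show lowIndex U p.height = i by omega), hp⟩
    vi_lo := fun e => (hlo e).1
    vi_hi := fun e => (hhi e).1
    joined_lo := fun e => (hlo e).2
    joined_hi := fun e => (hhi e).2 }⟩

end

/-! ### Numbering a gomic and conclusion -/

section

variable {X : Type u} [TopologicalSpace X] {f : X → ℝ} {A : Set ℝ} {ι : Type v} {U : ι → Set ℝ}

/-- By minimality no member can be left out of a finite subcover of the compact set `Z`. -/
theorem IsGomic.finite {Z : Set ℝ} (hU : IsGomic Z U) (hZ : IsCompact Z) : Finite ι := by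
  choose I hIo hIc hI using hU.isInterval
  obtain ⟨t, ht⟩ := hZ.elim_finite_subcover I hIo (by
    rw [← hU.covers]
    exact iUnion_mono fun α => by rw [hI]; exact inter_subset_left)
  have : (t : Set ι) = univ := by
    refine eq_univ_of_forall fun α => ?_
    by_contra hα
    refine hU.minimal α fun x hx => ?_
    rw [hI] at hx
    obtain ⟨β, hβ, hxβ⟩ := mem_iUnion₂.1 (ht hx.2)
    exact mem_iUnion₂.2 ⟨β, fun h => hα (h ▸ hβ), by rw [hI]; exact ⟨hxβ, hx.2⟩⟩
  exact finite_univ_iff.1 (this ▸ t.finite_toSet)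

/-- The members of a finite family can be numbered without gaps in the order of a given injective
function. -/
theorem exists_rank [Finite ι] {p : ι → ℝ} (hp : Function.Injective p) :
    ∃ r : ι → ℕ, (∀ α β, p α < p β ↔ r α < r β) ∧
      ∀ α γ, r α + 1 < r γ → ∃ β, p α < p β ∧ p β < p γ := by
  classical
  have := Fintype.ofFinite ι
  -- The rank of `α` is the number of members with smaller value. A jump in rank by more than one
  -- leaves an element of `s γ` outside `insert α (s α)`, which lies strictly between.
  let s : ι → Finset ι := fun α => Finset.univ.filter fun β => p β < p α
  have hs : ∀ {α β}, β ∈ s α ↔ p β < p α := by simp [s]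
  have hlt : ∀ α β, p α < p β → (s α).card < (s β).card := fun α β h =>
    Finset.card_lt_card ((Finset.ssubset_iff_of_subset fun γ hγ =>
      hs.2 ((hs.1 hγ).trans h)).2 ⟨α, hs.2 h, fun h' => lt_irrefl _ (hs.1 h')⟩)
  refine ⟨fun α => (s α).card, fun α β => ⟨hlt α β, fun h => ?_⟩, fun α γ h => ?_⟩
  · by_contra! hle
    obtain heq | hlt' := hle.eq_or_lt
    · exact h.ne (by rw [hp heq])
    · exact h.not_gt (hlt β α hlt')
  · obtain ⟨β, hβ, hβ'⟩ := Finset.exists_mem_notMem_of_card_lt_card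
      ((Finset.card_insert_le α (s α)).trans_lt h)
    rw [Finset.mem_insert, not_or, hs, not_lt] at hβ'
    exact ⟨β, lt_of_le_of_ne hβ'.2 fun h => hβ'.1 (hp h).symm, hs.1 hβ⟩

/-- The members of a gomic in which every member is an interval can be numbered to form a linear
cover. -/
theorem IsGomic.exists_isLinearCover [Finite ι] {Z : Set ℝ} (hU : IsGomic Z U)
    (hoc : ∀ α, (U α).OrdConnected) :
    ∃ r : ι → ℕ, Function.Injective r ∧
      IsLinearCover Z fun n => ⋃ (α : ι) (_ : r α = n), U α := by
  -- Minimality gives every member a private point; the members are numbered in the order of these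
  -- points.
  have hpr : ∀ α, ∃ x ∈ U α, ∀ β, β ≠ α → x ∉ U β := fun α => by
    obtain ⟨x, hx, hx'⟩ := not_subset.1 (hU.minimal α)
    exact ⟨x, hx, fun β hβ hxβ => hx' (mem_iUnion₂.2 ⟨β, hβ, hxβ⟩)⟩
  choose p hpU hpn using hpr
  have hp : Function.Injective p := fun α β h => by
    by_contra hne
    exact hpn β α hne (h ▸ hpU α)
  obtain ⟨r, hr, hr'⟩ := exists_rank hp
  have hrinj : Function.Injective r := fun α β h => by
    by_contra hne
    obtain hlt | hlt := lt_or_gt_of_ne (hp.ne hne)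
    · exact ((hr _ _).1 hlt).ne h
    · exact ((hr _ _).1 hlt).ne h.symm
  have hpn' : ∀ {α β}, p α < p β → p α ∉ U β ∧ p β ∉ U α := fun {α β} h =>
    have hne : α ≠ β := fun h' => h.ne (congrArg p h')
    ⟨hpn α β hne.symm, hpn β α hne⟩
  have hmem : ∀ {n : ℕ} {x : ℝ}, (x ∈ ⋃ (α : ι) (_ : r α = n), U α) ↔ ∃ α, r α = n ∧ x ∈ U α := by
    simp
  refine ⟨r, hrinj, ?_, ?_, ?_, ?_, ?_⟩
  · rw [← hU.covers]
    ext x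
    simp
  · intro n
    refine ⟨fun x hx y hy z hz => ?_⟩
    obtain ⟨α, rfl, hα⟩ := hmem.1 hx
    obtain ⟨β, hβ, hy'⟩ := hmem.1 hy
    obtain rfl := hrinj hβ
    exact hmem.2 ⟨β, rfl, (hoc β).out hα hy' hz⟩
  · intro n
    choose I hI _ hUI using hU.isInterval
    refine ⟨⋃ (α : ι) (_ : r α = n), I α, isOpen_iUnion fun α => isOpen_iUnion fun _ => hI α, ?_⟩
    simp only [hUI, iUnion_inter]
  · intro m n hmn
    rw [disjoint_left]
    intro x hx hx'
    obtain ⟨α, rfl, hα⟩ := hmem.1 hx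
    obtain ⟨γ, rfl, hγ⟩ := hmem.1 hx'
    obtain ⟨β, hαβ, hβγ⟩ := hr' α γ hmn
    -- A common point of `U α` and `U γ` would force the private point of the intermediate `U β`
    -- into one of them.
    obtain hle | hle := le_total x (p β)
    · exact (hpn' hβγ).1 ((hoc γ).out hγ (hpU γ) ⟨hle, hβγ.le⟩)
    · exact (hpn' hαβ).2 ((hoc α).out (hpU α) hα ⟨hαβ.le, hle⟩)
  · intro m n hmn x hx y hy hxy
    obtain ⟨α, rfl, hα⟩ := hmem.1 hx
    obtain ⟨β, rfl, hβ⟩ := hmem.1 hy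
    have hβα := (hr β α).2 hmn
    refine ⟨hmem.2 ⟨β, rfl, ?_⟩, hmem.2 ⟨α, rfl, ?_⟩⟩
    -- If `x` were left of `p β`, the interval `U α` would contain this private point of `U β`.
    · obtain hle | hlt := le_or_gt (p β) x
      · exact (hoc β).out (hpU β) hβ ⟨hle, hxy⟩
      · exact ((hpn' hβα).1 ((hoc α).out hα (hpU α) ⟨hlt.le, hβα.le⟩)).elim
    · obtain hle | hlt := le_or_gt y (p α)
      · exact (hoc α).out hα (hpU α) ⟨hxy, hle⟩
      · exact ((hpn' hβα).2 ((hoc β).out (hpU β) hβ ⟨hβα.le, hlt.le⟩)).elim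

section reindex

variable {r : ι → ℕ}

theorem mem_iUnion_reindex {n : ℕ} {x : ℝ} :
    (x ∈ ⋃ (α : ι) (_ : r α = n), U α) ↔ ∃ α, r α = n ∧ x ∈ U α := by
  simp

theorem iUnion_reindex (hr : Function.Injective r) (α : ι) :
    ⋃ (β : ι) (_ : r β = r α), U β = U α := by
  ext x
  simp [hr.eq_iff]

/-- Numbers not of the form `r α` index the empty set, which meets no edge and so is not counted. -/
theorem crossingCount_reindex (hr : Function.Injective r) (e : ReebEdge f A) :
    crossingCount (fun n => ⋃ (α : ι) (_ : r α = n), U α) e = crossingCount U e := by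
  rw [crossingCount, crossingCount, ← ncard_image_of_injective _ hr]
  congr 1
  ext n
  constructor
  · rintro ⟨hn, z, hz, hze⟩
    obtain ⟨α, rfl, hα⟩ := mem_iUnion_reindex.1 hz
    rw [iUnion_reindex hr] at hn
    exact ⟨α, ⟨hn, z, hα, hze⟩, rfl⟩
  · rintro ⟨α, hα, rfl⟩
    rw [mem_ofPred_eq, iUnion_reindex hr]
    exact hα

theorem overlapNodes_reindex (hr : Function.Injective r) :
    overlapNodes f A (fun n => ⋃ (α : ι) (_ : r α = n), U α) = overlapNodes f A U := by
  ext p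
  constructor
  · rintro ⟨m, n, hmn, hm, hn⟩
    obtain ⟨α, rfl, hα⟩ := mem_iUnion_reindex.1 hm
    obtain ⟨β, rfl, hβ⟩ := mem_iUnion_reindex.1 hn
    exact ⟨α, β, fun h => hmn (congrArg r h), hα, hβ⟩
  · rintro ⟨α, β, hαβ, hα, hβ⟩
    exact ⟨r α, r β, hr.ne hαβ, mem_iUnion_reindex.2 ⟨α, rfl, hα⟩,
      mem_iUnion_reindex.2 ⟨β, rfl, hβ⟩⟩

/-- The MultiNerve Mapper is the multinerve of the (possibly disconnected) preimages. -/
theorem nonempty_multinerveMapper_orderIso (hr : Function.Injective r) :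
    Nonempty (MultinerveMapper f U ≃o
      Multinerve fun n => f ⁻¹' ⋃ (α : ι) (_ : r α = n), U α) := by
  refine Multinerve.nonempty_orderIso_of_components (fun i => r i.1.1) ?_ ?_ ?_
  · rintro ⟨⟨α, C⟩, hC⟩
    rw [iUnion_reindex hr]
    exact hC
  · rintro ⟨⟨α, C⟩, hC⟩ ⟨⟨α', C'⟩, hC'⟩ h h'
    exact Subtype.ext (Prod.ext (hr h) h')
  · intro n C hC
    obtain ⟨x, hx⟩ := hC.nonempty
    -- A component is nonempty, so only numbers in the range of `r` occur.
    obtain ⟨α, rfl, -⟩ := mem_iUnion_reindex.1 (hC.subset hx)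
    rw [iUnion_reindex hr] at hC
    exact ⟨⟨⟨α, C⟩, hC⟩, rfl, rfl⟩

end reindex

theorem IsTelescopic.nonempty_multinerveMapper_orderIso (h : IsTelescopic f A)
    (hU : IsGomic (range f) U) (hcrit : ∀ α, (U α ∩ A).Subsingleton) :
    Nonempty (MultinerveMapper f U ≃o
      (((combReebGraph f A).subdivide (crossingCount U)).split
        (Sum.inl '' overlapNodes f A U)).Face) := by
  have := hU.finite h.isCompact_range
  have hoc : ∀ α, (U α).OrdConnected := fun α => by
    obtain ⟨I, -, hI, hUI⟩ := hU.isInterval α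
    rw [hUI]
    exact h.ordConnected_inter_range hI (hUI ▸ hcrit α)
  obtain ⟨r, hr, hc⟩ := hU.exists_isLinearCover hoc
  obtain ⟨M⟩ := nonempty_multinerveModel h hc (by
    intro n x hx y hy
    obtain ⟨α, rfl, -⟩ := mem_iUnion_reindex.1 hx.1
    rw [iUnion_reindex hr] at hx hy
    exact hcrit α hx hy)
  obtain ⟨φ⟩ := M.nonempty_orderIso
  obtain ⟨ψ⟩ := _root_.nonempty_multinerveMapper_orderIso (f := f) (U := U) hr
  rw [overlapNodes_reindex hr, funext (crossingCount_reindex hr)] at φ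
  exact ⟨ψ.trans φ⟩

end

theorem mainTheorem10 (T : Telescope.{u})
    (hbot : IsEmpty (T.Y 0)) (htop : IsEmpty (T.Y (Fin.last T.n)))
    {ι : Type v} (U : ι → Set ℝ) (hU : IsGomic (Set.range T.proj) U)
    (hcrit : ∀ α, (U α ∩ T.crit).Subsingleton) :
    Nonempty (MultinerveMapper T.proj U ≃o
      (((combReebGraph T.proj T.crit).subdivide (crossingCount U)).split
        (Sum.inl '' overlapNodes T.proj T.crit U)).Face) :=
  (T.isTelescopic hbot htop).nonempty_multinerveMapper_orderIso hU hcrit
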